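/- **Syntax-Knowledge model.** Let $0\le\alpha<1$ and $\beta>-\alpha$. In the Pitman–Yor Chinese Restaurant Process with parameters $(\alpha,\beta)$ the first customer opens a table, and the $n$-th customer ($n\ge 2$) joins an occupied table $k$ with probability $(N_k-\alpha)/(n-1+\beta)$ or opens a new table with probability $(\beta+\alpha K)/(n-1+\beta)$, where $N_k$ is the current number of customers at table $k$ and $K$ the number of occupied tables. With tables numbered in order of appearance, let $p_k=\lim_n N_k/n$ (the limits exist and sum to $1$ almost surely). For a probability measure $\pi$, $\mathsf{PYP}(\alpha,\beta,\pi)$ is the law of the random probability measure $\sum_k p_k\delta_{\phi_k}$, where the $\phi_k$ are i.i.d. with law $\pi$ and independent of $(p_k)$. Let $\mathbf\Phi_{\rm knw}$ and $\mathbf\Phi_{\rm syn}$ be the closed Euclidean unit balls of $\mathbb R^{d_{\rm knw}}$ and $\mathbb R^{d_{\rm syn}}$, with prior probability measures $\pi_{\rm knw}$ and $\pi_{\rm syn}$. Let $\mathbb K$ be a finite set and $\Xi$, $\mathcal X$ standard Borel spaces (for instance countable discrete sets). Let $(P_\phi)_{\phi\in\mathbf\Phi_{\rm knw}}$ and $(P_\phi)_{\phi\in\mathbf\Phi_{\rm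 syn}}$ be measurable families of probability distributions on $\mathbb K$ and $\Xi$, let $s:\mathbb K\to\{1,\dots,n_s\}$ be a map, and let $e:\mathbb K\times\Xi\to\mathcal X$ be measurable and injective. The random data parameter is $\phi_{\rm data}=(\phi_{\rm knw},(\phi^{(i)}_{\rm syn})_{i\le n_s})$, where $\phi_{\rm knw}\sim\mathsf{PYP}(\alpha,\beta,\pi_{\rm knw})$ and, independently, the $\phi^{(i)}_{\rm syn}$ are i.i.d. with law $\pi_{\rm syn}$; its law is denoted $\pi$. Given $\phi_{\rm data}$, a sentence is $X=e(\kappa,\xi)$, where $\kappa\sim\int P_\phi\,\phi_{\rm knw}(d\phi)$ and, given $\kappa$, $\xi\sim P_{\phi_{\rm syn}^{(s(\kappa))}}$; its law is $P_{\phi_{\rm data}}$. Given $\phi_{\rm data}$, the sentences $X_1,\dots,X_N$ are i.i.d. with law $P_{\phi_{\rm data}}$. For a probability measure $M$ on $\mathcal X^N$ let $\mathsf{Red}_N(M)=\int D_{\rm KL}(P_{\phi_{\rm data}}^{N}\,\|\,M)\,\pi(d\phi_{\rm data})$ be its Bayesian redundancy. **Assumption (Lipschitz KL).** There are constants $L_{\rm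 knw},L_{\rm syn}>0$ with $D_{\rm KL}(P_{\phi}\|P_{\phi'})\le L_{\rm knw}\|\phi-\phi'\|_2^2$ for all $\phi,\phi'\in\mathbf\Phi_{\rm knw}$, and $D_{\rm KL}(P_{\phi}\|P_{\phi'})\le L_{\rm syn}\|\phi-\phi'\|_2^2$ for all $\phi,\phi'\in\mathbf\Phi_{\rm syn}$. **Theorem.** Under this assumption, for every $N\ge1$, $$\inf_{M}\frac1N\mathsf{Red}_N(M)=\frac1N\,\mathbb I(X_{1:N};\phi_{\rm data})=\widetilde O\Big(\frac{d_{\rm knw}}{N^{1-\alpha}}+\frac{n_s\,d_{\rm syn}}{N}\Big),$$ where the infimum is over all probability measures $M$ on $\mathcal X^N$ and $\widetilde O$ hides polylogarithmic factors, in the following sense: there are $C>0$ and $r\in\mathbb N$ that depend only on $(\alpha,\beta)$ such that, for all models as above and all $N\ge 1$, $$\frac1N\,\mathbb I(X_{1:N};\phi_{\rm data})\le C\Big(\frac{d_{\rm knw}}{N^{1-\alpha}}\log^r(2+N+L_{\rm knw}+d_{\rm knw}+|\mathbb K|)+\frac{n_sd_{\rm syn}}{N}\log^r(2+N+L_{\rm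 syn}+d_{\rm syn})\Big).$$ -/

import Mathlib

open MeasureTheory ProbabilityTheory Filter
open scoped ENNReal

universe u v w

namespace SyntaxKnowledge

noncomputable section

/-! ### The Pitman-Yor Chinese Restaurant Process -/

/-- Parameters of a Pitman-Yor process: discount `0 ≤ α < 1`, concentration `β > -α`. -/
structure PYParam where
  /-- the discount parameter -/
  α : ℝ
  /-- the concentration parameter -/
  β : ℝ
  zero_le_α : 0 ≤ α
  α_lt_one : α < 1
  neg_α_lt_β : -α < β

/-- The tables occupied after the customers `0, …, n` have been seated according to `h`. -/
def occupied {n : ℕ} (h : Finset.Iic n → ℕ) : Finset ℕ := Finset.univ.image h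

/-- The number of customers among `0, …, n` that sit at table `k`. -/
def tableCount {n : ℕ} (h : Finset.Iic n → ℕ) (k : ℕ) : ℕ :=
  (Finset.univ.filter fun i => h i = k).card

/-- The label of the next new table: the least label that is not yet in use. Tables are hence
numbered `0, 1, 2, …` in their order of appearance. -/
def freshTable {n : ℕ} (h : Finset.Iic n → ℕ) : ℕ := sInf {k : ℕ | k ∉ occupied h}

/-- The law of the table of the next customer, when `n + 1` customers are already seated: table `k`
with probability `(N_k - α) / (n + 1 + β)`, a new table with probability
`(β + α K) / (n + 1 + β)`, `K` being the number of occupied tables. -/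
def seatMeasure (P : PYParam) {n : ℕ} (h : Finset.Iic n → ℕ) : Measure ℕ :=
  (∑ k ∈ occupied h,
      ENNReal.ofReal (((tableCount h k : ℝ) - P.α) / ((n : ℝ) + 1 + P.β)) • Measure.dirac k) +
    ENNReal.ofReal ((P.β + P.α * ((occupied h).card : ℝ)) / ((n : ℝ) + 1 + P.β)) •
      Measure.dirac (freshTable h)

/-- The seating rule as a transition kernel from seating histories to the next table. -/
def seatKernel (P : PYParam) (n : ℕ) : Kernel (Finset.Iic n → ℕ) ℕ where
  toFun h := seatMeasure P h
  measurable' := Measurable.of_discrete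

lemma one_le_tableCount {n : ℕ} (h : Finset.Iic n → ℕ) {k : ℕ} (hk : k ∈ occupied h) :
    1 ≤ tableCount h k := by
  obtain ⟨i, -, hi⟩ := Finset.mem_image.1 hk
  exact Finset.card_pos.2 ⟨i, by simp [hi]⟩

lemma sum_tableCount {n : ℕ} (h : Finset.Iic n → ℕ) :
    ∑ k ∈ occupied h, tableCount h k = n + 1 := by
  have := Finset.card_eq_sum_card_image h (Finset.univ : Finset (Finset.Iic n))
  simp only [Finset.card_univ, Fintype.card_coe, Nat.card_Iic] at this
  exact this.symm

lemma occupied_nonempty {n : ℕ} (h : Finset.Iic n → ℕ) : (occupied h).Nonempty :=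
  ⟨h ⟨n, Finset.mem_Iic.2 le_rfl⟩, Finset.mem_image_of_mem _ (Finset.mem_univ _)⟩

instance (P : PYParam) (n : ℕ) : IsMarkovKernel (seatKernel P n) where
  isProbabilityMeasure h := by
    constructor
    have h0 := P.zero_le_α
    have h1 := P.α_lt_one
    have h2 := P.neg_α_lt_β
    have hden : (0 : ℝ) < (n : ℝ) + 1 + P.β := by
      have : (0 : ℝ) ≤ n := Nat.cast_nonneg n
      linarith
    have hcard : (1 : ℝ) ≤ ((occupied h).card : ℝ) := by
      exact_mod_cast Finset.card_pos.2 (occupied_nonempty h)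
    have hnum : 0 ≤ P.β + P.α * ((occupied h).card : ℝ) := by nlinarith
    have hpos : ∀ k ∈ occupied h,
        0 ≤ ((tableCount h k : ℝ) - P.α) / ((n : ℝ) + 1 + P.β) := by
      intro k hk
      have : (1 : ℝ) ≤ (tableCount h k : ℝ) := by exact_mod_cast one_le_tableCount h hk
      exact div_nonneg (by linarith) hden.le
    have hs : (∑ k ∈ occupied h, (tableCount h k : ℝ)) = (n : ℝ) + 1 := by
      exact_mod_cast sum_tableCount h
    change seatMeasure P h Set.univ = 1
    simp only [seatMeasure, Measure.add_apply, Measure.coe_finsetSum, Finset.sum_apply,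
      Measure.smul_apply, measure_univ, smul_eq_mul, mul_one]
    rw [← ENNReal.ofReal_sum_of_nonneg hpos, ← ENNReal.ofReal_add (Finset.sum_nonneg hpos)
      (div_nonneg hnum hden.le), ← Finset.sum_div, Finset.sum_sub_distrib, hs, ← add_div]
    rw [Finset.sum_const, nsmul_eq_mul]
    rw [show (n : ℝ) + 1 - ((occupied h).card : ℝ) * P.α +
      (P.β + P.α * ((occupied h).card : ℝ)) = (n : ℝ) + 1 + P.β by ring, div_self hden.ne',
      ENNReal.ofReal_one]

/-- The law of the Chinese Restaurant Process: `ω n` is the table of customer `n`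
(customers are counted from `0`); the first customer sits at table `0`. -/
def crp (P : PYParam) : Measure (ℕ → ℕ) :=
  Kernel.trajMeasure (X := fun _ => ℕ) (Measure.dirac 0) (seatKernel P)

instance (P : PYParam) : IsProbabilityMeasure (crp P) :=
  inferInstanceAs <| IsProbabilityMeasure
    (Kernel.trajMeasure (X := fun _ => ℕ) (Measure.dirac 0) (seatKernel P))

/-- The proportion `N_k / n` of the first `n` customers that sit at table `k`. -/
def tableFreq (ω : ℕ → ℕ) (n k : ℕ) : ℝ≥0∞ :=
  (((Finset.range n).filter fun i => ω i = k).card : ℝ≥0∞) / (n : ℝ≥0∞)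

/-- The weight `p_k = lim N_k / n` of table `k`. It is written as a lower limit, which is the limit
whenever the latter exists. -/
def pyWeight (ω : ℕ → ℕ) (k : ℕ) : ℝ≥0∞ := liminf (fun n => tableFreq ω n k) atTop

@[fun_prop]
lemma measurable_tableFreq (n k : ℕ) : Measurable fun ω => tableFreq ω n k := by
  have : (fun ω : ℕ → ℕ => tableFreq ω n k) =
      (fun c : ℕ → ℕ => (((Finset.range n).filter fun i => c i = k).card : ℝ≥0∞) / (n : ℝ≥0∞)) :=
    rfl
  rw [this]
  simp only [Finset.card_filter, Nat.cast_sum]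
  refine Measurable.div_const (Finset.measurable_sum _ fun i _ => ?_) _
  have hi : Measurable fun m : ℕ => (((if m = k then 1 else 0 : ℕ)) : ℝ≥0∞) :=
    Measurable.of_discrete
  exact hi.comp (measurable_pi_apply i)

@[fun_prop]
lemma measurable_pyWeight (k : ℕ) : Measurable fun ω => pyWeight ω k :=
  Measurable.liminf fun n => measurable_tableFreq n k

/-! ### The Pitman-Yor process -/

section PitmanYor

variable {E : Type*} [MeasurableSpace E]

/-- The measure `∑ p_k δ_{φ_k}` built from a seating `x.1` and atoms `x.2`. -/
def weightedAtoms (x : (ℕ → ℕ) × (ℕ → E)) : Measure E :=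
  Measure.sum fun k => pyWeight x.1 k • Measure.dirac (x.2 k)

lemma weightedAtoms_univ (x : (ℕ → ℕ) × (ℕ → E)) :
    weightedAtoms x Set.univ = ∑' k, pyWeight x.1 k := by
  simp [weightedAtoms]

open Classical in
/-- The random probability measure `φ_knw = ∑ p_k δ_{φ_k}`. The lower limits `p_k` sum to `1`
exactly when all the limits of the `N_k / n` exist and form a probability vector, which happens
almost surely under `crp`; on the remaining null set the value is irrelevant. -/
def pyProb (x : (ℕ → ℕ) × (ℕ → E)) : ProbabilityMeasure E :=
  if h : ∑' k, pyWeight x.1 k = 1 then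
    ⟨weightedAtoms x, ⟨(weightedAtoms_univ x).trans h⟩⟩
  else ⟨Measure.dirac (x.2 0), inferInstance⟩

lemma measurable_weightedAtoms :
    Measurable (weightedAtoms : (ℕ → ℕ) × (ℕ → E) → Measure E) := by
  refine Measure.measurable_of_measurable_coe _ fun s hs => ?_
  have : (fun x : (ℕ → ℕ) × (ℕ → E) => weightedAtoms x s) =
      fun x => ∑' k, pyWeight x.1 k * s.indicator (fun _ => (1 : ℝ≥0∞)) (x.2 k) := by
    funext x
    simp [weightedAtoms, Measure.sum_apply _ hs, Measure.dirac_apply' _ hs, Set.indicator]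
  rw [this]
  refine Measurable.tsum fun k => ?_
  refine ((measurable_pyWeight k).comp measurable_fst).mul ?_
  exact (measurable_const.indicator hs).comp ((measurable_pi_apply k).comp measurable_snd)

lemma coe_pyProb_of_eq {x : (ℕ → ℕ) × (ℕ → E)} (h : ∑' k, pyWeight x.1 k = 1) :
    ((pyProb x : ProbabilityMeasure E) : Measure E) = weightedAtoms x :=
  congrArg Subtype.val (dif_pos h)

lemma coe_pyProb_of_ne {x : (ℕ → ℕ) × (ℕ → E)} (h : ¬ ∑' k, pyWeight x.1 k = 1) :
    ((pyProb x : ProbabilityMeasure E) : Measure E) = Measure.dirac (x.2 0) :=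
  congrArg Subtype.val (dif_neg h)

lemma measurable_pyProb :
    Measurable (pyProb : (ℕ → ℕ) × (ℕ → E) → ProbabilityMeasure E) := by
  classical
  refine Measurable.subtype_mk (f := fun x : (ℕ → ℕ) × (ℕ → E) =>
    ((pyProb x : ProbabilityMeasure E) : Measure E)) ?_
  have : (fun x : (ℕ → ℕ) × (ℕ → E) => ((pyProb x : ProbabilityMeasure E) : Measure E)) =
      fun x => if ∑' k, pyWeight x.1 k = 1 then weightedAtoms x else Measure.dirac (x.2 0) := by
    funext x
    by_cases h : ∑' k, pyWeight x.1 k = 1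
    · rw [if_pos h, coe_pyProb_of_eq h]
    · rw [if_neg h, coe_pyProb_of_ne h]
  rw [this]
  refine Measurable.ite ?_ measurable_weightedAtoms
    (Measure.measurable_dirac.comp ((measurable_pi_apply 0).comp measurable_snd))
  exact (Measurable.tsum fun k => (measurable_pyWeight k).comp measurable_fst)
    (measurableSet_singleton 1)

/-- The law `PYP(α, β, π)` of the random probability measure `∑ p_k δ_{φ_k}`: the weights come from
the Chinese Restaurant Process, and independently the atoms `φ_k` are i.i.d. with law `π`. -/
def pyp (P : PYParam) (π : Measure E) [IsProbabilityMeasure π] :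
    Measure (ProbabilityMeasure E) :=
  ((crp P).prod (Measure.infinitePi fun _ : ℕ => π)).map pyProb

instance (P : PYParam) (π : Measure E) [IsProbabilityMeasure π] :
    IsProbabilityMeasure (pyp P π) :=
  Measure.isProbabilityMeasure_map measurable_pyProb.aemeasurable

end PitmanYor

/-! ### Redundancy and mutual information -/

section Information

variable {Θ S : Type*} [MeasurableSpace Θ] [MeasurableSpace S]

/-- The law `P_θ^N` of `N` i.i.d. samples from `κ θ`, as a kernel in `θ`. -/
def iidKernel (κ : Kernel Θ S) [IsMarkovKernel κ] (N : ℕ) : Kernel Θ (Fin N → S) where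
  toFun θ := Measure.pi fun _ => κ θ
  measurable' := by
    refine Measurable.measure_of_isPiSystem_of_isProbabilityMeasure
      generateFrom_pi.symm isPiSystem_pi ?_
    rintro _ ⟨t, ht, rfl⟩
    simp only [Set.mem_pi, Set.mem_univ, forall_const, Set.mem_ofPred_eq] at ht
    simp only [Measure.pi_pi]
    exact Finset.measurable_prod _ fun i _ => Kernel.measurable_coe κ (ht i)

instance (κ : Kernel Θ S) [IsMarkovKernel κ] (N : ℕ) : IsMarkovKernel (iidKernel κ N) where
  isProbabilityMeasure θ :=
    inferInstanceAs <| IsProbabilityMeasure (Measure.pi fun _ : Fin N => κ θ)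

/-- The Bayesian redundancy `∫ D_KL(P_θ^N ‖ M) π(dθ)` of a model `M`, which is a probability
distribution on sequences of length `N`. -/
def bayesRedundancy (prior : Measure Θ) (κ : Kernel Θ S) [IsMarkovKernel κ] (N : ℕ)
    (M : ProbabilityMeasure (Fin N → S)) : ℝ≥0∞ :=
  ∫⁻ θ, InformationTheory.klDiv (iidKernel κ N θ) (M : Measure (Fin N → S)) ∂prior

/-- The mutual information between `θ ∼ prior` and `X ∼ κ θ`: the Kullback-Leibler divergence of
the joint law from the product of its marginals. -/
def mutualInfo (prior : Measure Θ) (κ : Kernel Θ S) : ℝ≥0∞ :=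
  InformationTheory.klDiv (prior ⊗ₘ κ) (prior.prod (κ ∘ₘ prior))

end Information

/-! ### The Syntax-Knowledge model -/

/-- The parameter space `{φ ∈ ℝ^d : ‖φ‖₂ ≤ 1}`. -/
abbrev ParamBall (d : ℕ) : Type := Metric.closedBall (0 : EuclideanSpace ℝ (Fin d)) 1

/-- `D_KL(P_φ ‖ P_φ') ≤ L ‖φ - φ'‖²` for all parameters `φ`, `φ'`. -/
def LipschitzKL {d : ℕ} {A : Type*} [MeasurableSpace A] (κ : Kernel (ParamBall d) A) (L : ℝ) :
    Prop :=
  ∀ φ φ' : ParamBall d, InformationTheory.klDiv (κ φ) (κ φ') ≤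
    ENNReal.ofReal (L * ‖(φ : EuclideanSpace ℝ (Fin d)) - (φ' : EuclideanSpace ℝ (Fin d))‖ ^ 2)

/-- The data parameter `φ_data = (φ_knw, φ_syn)`: a mixing distribution on the knowledge cluster
parameters and `ns` syntax cluster parameters. -/
abbrev DataParam (dknw dsyn ns : ℕ) : Type :=
  ProbabilityMeasure (ParamBall dknw) × (Fin ns → ParamBall dsyn)

/-- The prior of `φ_data`: `φ_knw ∼ PYP(α, β, π_knw)`, and independently the `φ_syn^(i)` are i.i.d.
with law `π_syn`. -/
def dataPrior (P : PYParam) {dknw dsyn : ℕ} (πknw : Measure (ParamBall dknw))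
    [IsProbabilityMeasure πknw] (πsyn : Measure (ParamBall dsyn)) (ns : ℕ) :
    Measure (DataParam dknw dsyn ns) :=
  (pyp P πknw).prod (Measure.pi fun _ : Fin ns => πsyn)

instance (P : PYParam) {dknw dsyn : ℕ} (πknw : Measure (ParamBall dknw))
    [IsProbabilityMeasure πknw] (πsyn : Measure (ParamBall dsyn)) [IsProbabilityMeasure πsyn]
    (ns : ℕ) : IsProbabilityMeasure (dataPrior P πknw πsyn ns) :=
  inferInstanceAs <| IsProbabilityMeasure
    ((pyp P πknw).prod (Measure.pi fun _ : Fin ns => πsyn))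

/-- The identity kernel `μ ↦ μ`: draw a cluster parameter from the mixing distribution `μ`. -/
def drawCluster (E : Type*) [MeasurableSpace E] : Kernel (ProbabilityMeasure E) E where
  toFun μ := (μ : Measure E)
  measurable' := measurable_subtype_coe

instance (E : Type*) [MeasurableSpace E] : IsMarkovKernel (drawCluster E) where
  isProbabilityMeasure μ := inferInstanceAs <| IsProbabilityMeasure (μ : Measure E)

section Model

variable {dknw dsyn ns : ℕ} {𝕂 : Type u} {Ξ : Type v} {S : Type w}
  [MeasurableSpace 𝕂] [Countable 𝕂] [MeasurableSingletonClass 𝕂]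
  [MeasurableSpace Ξ] [MeasurableSpace S]

/-- The knowledge element: draw a cluster `φ` from `φ_knw`, then `κ ∼ P_φ`. -/
def knowledgeKernel (knw : Kernel (ParamBall dknw) 𝕂) : Kernel (DataParam dknw dsyn ns) 𝕂 :=
  (knw ∘ₖ drawCluster (ParamBall dknw)).comap Prod.fst measurable_fst

instance (knw : Kernel (ParamBall dknw) 𝕂) [IsMarkovKernel knw] :
    IsMarkovKernel (knowledgeKernel (dsyn := dsyn) (ns := ns) knw) :=
  inferInstanceAs <| IsMarkovKernel
    ((knw ∘ₖ drawCluster (ParamBall dknw)).comap Prod.fst measurable_fst)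

/-- The syntax parameter `φ_syn^(i)` in use, where `i = sel κ` is the syntax cluster that is
selected by the knowledge element `κ`. -/
def activeSyntax (sel : 𝕂 → Fin ns) (x : DataParam dknw dsyn ns × 𝕂) : ParamBall dsyn :=
  x.1.2 (sel x.2)

lemma measurable_activeSyntax (sel : 𝕂 → Fin ns) :
    Measurable (activeSyntax (dknw := dknw) (dsyn := dsyn) sel) :=
  measurable_from_prod_countable_left fun k =>
    (measurable_pi_apply (sel k)).comp measurable_snd

/-- The syntactic element: `ξ ∼ P(· ∣ φ_syn^(sel κ))`, given `φ_data` and `κ`. -/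
def syntaxKernel (syn : Kernel (ParamBall dsyn) Ξ) (sel : 𝕂 → Fin ns) :
    Kernel (DataParam dknw dsyn ns × 𝕂) Ξ :=
  syn.comap (activeSyntax sel) (measurable_activeSyntax sel)

instance (syn : Kernel (ParamBall dsyn) Ξ) [IsMarkovKernel syn] (sel : 𝕂 → Fin ns) :
    IsMarkovKernel (syntaxKernel (dknw := dknw) syn sel) :=
  inferInstanceAs <| IsMarkovKernel (syn.comap (activeSyntax sel) (measurable_activeSyntax sel))

/-- The law `P_{φ_data}` of one sentence `X = enc (κ, ξ)`. -/
def sentenceKernel (knw : Kernel (ParamBall dknw) 𝕂) (syn : Kernel (ParamBall dsyn) Ξ)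
    (sel : 𝕂 → Fin ns) (enc : 𝕂 × Ξ → S) (_henc : Measurable enc) :
    Kernel (DataParam dknw dsyn ns) S :=
  (knowledgeKernel knw ⊗ₖ syntaxKernel syn sel).map enc

instance (knw : Kernel (ParamBall dknw) 𝕂) [IsMarkovKernel knw]
    (syn : Kernel (ParamBall dsyn) Ξ) [IsMarkovKernel syn] (sel : 𝕂 → Fin ns)
    (enc : 𝕂 × Ξ → S) (henc : Measurable enc) :
    IsMarkovKernel (sentenceKernel knw syn sel enc henc) :=
  Kernel.IsMarkovKernel.map _ henc

end Model

end

end SyntaxKnowledge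

open SyntaxKnowledge

/-!
The identity between the least Bayesian redundancy and the mutual information is the compensation
identity. The redundancy of `M` is the divergence of the joint law of (parameter, sample) from
`prior × M` (`lintegral_klDiv_const_eq`), and by the chain rule, conditioning on the sample, this
divergence is least when `M` is the marginal law of the sample (`klDiv_prod_snd_le`).

For the upper bound it thus suffices to exhibit one model `M` of `N` sentences with small
redundancy, and `M` is a mixture of finitely many codewords (`exists_model`). A codeword is selected
by a number `n` of clusters, rounded cluster weights, cluster parameters from a grid, and syntax
parameters from a grid; knowledge elements from clusters that are not listed are modelled as uniform
on `𝕂`. An equal-weight mixture pays the logarithm of the number of its components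
(`klDiv_uniformMixture_le`), and the approximation error is controlled by the Lipschitz assumption,
by the chain rule and by data processing (`exists_knowledgeCode`, `mul_klDiv_sentenceLaw_le`). If
the mixing distribution has `n` listed atoms and a remainder of mass `t`, then the knowledge part
costs `O(dknw (n + N t))` up to logarithms.

The listed atoms are taken to be the tables that are occupied by the first `N` customers of the
restaurant which generates the mixing distribution. Their expected number is `O(N ^ α log N)` by a
one-step recursion (`exists_lintegral_card_tables_le`). Seen from time `N` on, the later tables
together form one colour of a Pólya urn of initial weight `β + α n` (`lintegral_lateCount_add_le`);
hence by Fatou's lemma their expected limiting weight is `O((β + α n) / N)`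
(`lintegral_tailWeight_le`), and `N t` is of the same order as `n`. This replaces both
exchangeability and the convergence of the table frequencies: only an upper bound on the lower
limits is needed.
-/

namespace SyntaxKnowledge

open InformationTheory

/-! ### Kullback-Leibler divergence -/

section Divergence

variable {A B : Type*} [MeasurableSpace A] [MeasurableSpace B]

theorem rnDeriv_compProd_right_ae_eq [MeasurableSpace.CountableOrCountablyGenerated A B]
    (μ : Measure A) [IsFiniteMeasure μ] (κ η : Kernel A B) [IsMarkovKernel κ] [IsMarkovKernel η]
    (h : μ ⊗ₘ κ ≪ μ ⊗ₘ η) :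
    (μ ⊗ₘ κ).rnDeriv (μ ⊗ₘ η) =ᵐ[μ ⊗ₘ η] fun p => κ.rnDeriv η p.1 p.2 := by
  have h' := Measure.absolutelyContinuous_compProd_right_iff.1 h
  have hd : μ ⊗ₘ κ = (μ ⊗ₘ η).withDensity (fun p => κ.rnDeriv η p.1 p.2) := by
    rw [← Measure.compProd_withDensity (κ.measurable_rnDeriv η)]
    refine Measure.compProd_congr ?_
    filter_upwards [h'] with a ha using (Kernel.withDensity_rnDeriv_eq ha).symm
  conv_lhs => rw [hd]
  exact Measure.rnDeriv_withDensity _ (κ.measurable_rnDeriv η)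

/-- The conditional divergence as an average: this is the integral form of the second term of the
chain rule. Countability of `A` or countable generation of the `σ`-algebra of `B` gives a jointly
measurable version of the densities `dκ(a) / dη(a)`. -/
theorem klDiv_compProd_right_eq_lintegral [MeasurableSpace.CountableOrCountablyGenerated A B]
    (μ : Measure A) [IsFiniteMeasure μ] (κ η : Kernel A B) [IsMarkovKernel κ] [IsMarkovKernel η] :
    klDiv (μ ⊗ₘ κ) (μ ⊗ₘ η) = ∫⁻ a, klDiv (κ a) (η a) ∂μ := by
  by_cases h : μ ⊗ₘ κ ≪ μ ⊗ₘ η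
  · have h' := Measure.absolutelyContinuous_compProd_right_iff.1 h
    have hm : Measurable fun p : A × B =>
        ENNReal.ofReal (klFun (κ.rnDeriv η p.1 p.2).toReal) :=
      (measurable_klFun.comp (κ.measurable_rnDeriv η).ennreal_toReal).ennreal_ofReal
    rw [klDiv_eq_lintegral_klFun_of_ac h]
    calc ∫⁻ p, ENNReal.ofReal (klFun ((μ ⊗ₘ κ).rnDeriv (μ ⊗ₘ η) p).toReal) ∂(μ ⊗ₘ η)
        = ∫⁻ p, ENNReal.ofReal (klFun (κ.rnDeriv η p.1 p.2).toReal) ∂(μ ⊗ₘ η) := by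
          refine lintegral_congr_ae ?_
          filter_upwards [rnDeriv_compProd_right_ae_eq μ κ η h] with p hp
          rw [hp]
      _ = ∫⁻ a, ∫⁻ b, ENNReal.ofReal (klFun (κ.rnDeriv η a b).toReal) ∂(η a) ∂μ :=
          Measure.lintegral_compProd hm
      _ = ∫⁻ a, klDiv (κ a) (η a) ∂μ := by
          refine lintegral_congr_ae ?_
          filter_upwards [h'] with a ha
          rw [klDiv_eq_lintegral_klFun_of_ac ha]
          refine lintegral_congr_ae ?_
          filter_upwards [Kernel.rnDeriv_eq_rnDeriv_measure (κ := κ) (η := η) (a := a)] with b hb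
          rw [hb]
  · rw [klDiv_of_not_ac h, eq_comm, eq_top_iff]
    have hmeas : MeasurableSet {a | κ a ≪ η a} := Kernel.measurableSet_absolutelyContinuous κ η
    have hpos : μ {a | κ a ≪ η a}ᶜ ≠ 0 := fun h0 =>
      h (Measure.absolutelyContinuous_compProd_right_iff.2 h0)
    calc (∞ : ℝ≥0∞) = ∫⁻ a in {a | κ a ≪ η a}ᶜ, ∞ ∂μ := by
          rw [setLIntegral_const, ENNReal.top_mul hpos]
      _ = ∫⁻ a in {a | κ a ≪ η a}ᶜ, klDiv (κ a) (η a) ∂μ :=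
          setLIntegral_congr_fun hmeas.compl fun a ha => (klDiv_of_not_ac ha).symm
      _ ≤ ∫⁻ a, klDiv (κ a) (η a) ∂μ := setLIntegral_le_lintegral _ _

/-- A joint law that is absolutely continuous with respect to a product disintegrates over its
second coordinate. The disintegration is read off from the density, so that no topological
assumption on the spaces is needed. -/
theorem exists_kernel_swap_eq_compProd (μ : Measure A) [IsProbabilityMeasure μ] (ν : Measure B)
    [IsProbabilityMeasure ν] (J : Measure (A × B)) [IsProbabilityMeasure J] (h : J ≪ μ.prod ν) :
    ∃ ρ : Kernel B A, IsMarkovKernel ρ ∧ J.map Prod.swap = J.snd ⊗ₘ ρ := by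
  classical
  set f : A × B → ℝ≥0∞ := J.rnDeriv (μ.prod ν) with hf
  have hfm : Measurable f := Measure.measurable_rnDeriv _ _
  have hfb : ∀ b, Measurable fun a => f (a, b) := fun b => hfm.comp measurable_prodMk_right
  have hJ : J = (μ.prod ν).withDensity f := (Measure.withDensity_rnDeriv_eq _ _ h).symm
  set q : B → ℝ≥0∞ := fun b => ∫⁻ a, f (a, b) ∂μ with hq
  have hqm : Measurable q := hfm.lintegral_prod_left'
  have hqint : ∫⁻ b, q b ∂ν = 1 := by
    rw [hq, ← lintegral_prod_symm _ hfm.aemeasurable, ← setLIntegral_univ,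
      ← withDensity_apply _ MeasurableSet.univ, ← hJ, measure_univ]
  have hqfin : ∀ᵐ b ∂ν, q b < ∞ := ae_lt_top hqm (by simp [hqint])
  set g : B → A → ℝ≥0∞ := fun b a => if q b = 0 ∨ q b = ∞ then 1 else f (a, b) / q b with hg
  have hgm : Measurable (Function.uncurry g) := by
    have hs : MeasurableSet {p : B × A | q p.1 = 0 ∨ q p.1 = ∞} :=
      ((hqm.comp measurable_fst) (measurableSet_singleton 0)).union
        ((hqm.comp measurable_fst) (measurableSet_singleton ∞))
    exact Measurable.ite hs measurable_const
      ((hfm.comp measurable_swap).div (hqm.comp measurable_fst))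
  have hgb : ∀ b, Measurable (g b) := fun b => hgm.comp measurable_prodMk_left
  have hgint : ∀ b, ∫⁻ a, g b a ∂μ = 1 := by
    intro b
    by_cases hb : q b = 0 ∨ q b = ∞
    · simp [hg, hb]
    · simp only [hg, hb, if_false, div_eq_mul_inv]
      rw [lintegral_mul_const _ (hfb b)]
      exact ENNReal.mul_inv_cancel (fun h0 => hb (Or.inl h0)) (fun h0 => hb (Or.inr h0))
  set ρ : Kernel B A := (Kernel.const B μ).withDensity g with hρ
  have hρm : IsMarkovKernel ρ := ⟨fun b => ⟨by
    rw [hρ, Kernel.withDensity_apply _ hgm, withDensity_apply _ MeasurableSet.univ,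
      setLIntegral_univ, Kernel.const_apply, hgint]⟩⟩
  refine ⟨ρ, hρm, ?_⟩
  have hsnd : J.snd = ν.withDensity q := by
    ext s hs
    rw [Measure.snd_apply hs, hJ, withDensity_apply _ (measurable_snd hs), withDensity_apply _ hs,
      ← lintegral_indicator (measurable_snd hs),
      lintegral_prod_symm _ (hfm.indicator (measurable_snd hs)).aemeasurable,
      ← lintegral_indicator hs]
    refine lintegral_congr fun b => ?_
    by_cases hb : b ∈ s <;> simp [Set.indicator, hb, hq]
  have : IsProbabilityMeasure J.snd := inferInstance
  have hzero : ∀ b, q b = 0 → ∀ᵐ a ∂μ, f (a, b) = 0 := fun b hb =>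
    (lintegral_eq_zero_iff (hfb b)).1 hb
  ext s hs
  rw [Measure.map_apply measurable_swap hs, hJ, withDensity_apply _ (measurable_swap hs),
    ← hJ, Measure.compProd_apply hs, hsnd,
    lintegral_withDensity_eq_lintegral_mul _ hqm (Kernel.measurable_kernel_prodMk_left hs),
    ← lintegral_indicator (measurable_swap hs),
    lintegral_prod_symm _ (hfm.indicator (measurable_swap hs)).aemeasurable]
  refine lintegral_congr_ae ?_
  filter_upwards [hqfin] with b hb
  have hsb : MeasurableSet (Prod.mk b ⁻¹' s) := measurable_prodMk_left hs
  simp only [Pi.mul_apply, hρ]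
  rw [Kernel.withDensity_apply _ hgm, withDensity_apply _ hsb, Kernel.const_apply,
    ← lintegral_const_mul _ (hgb b), ← lintegral_indicator hsb]
  by_cases hb0 : q b = 0
  · refine lintegral_congr_ae ?_
    filter_upwards [hzero b hb0] with a ha
    simp [Set.indicator, ha, hb0]
  · refine lintegral_congr fun a => ?_
    have : q b * (f (a, b) / q b) = f (a, b) := ENNReal.mul_div_cancel hb0 hb.ne
    simp [Set.indicator, hg, hb0, hb.ne, this]

theorem klDiv_map_swap (μ ν : Measure (A × B)) [IsFiniteMeasure μ] [IsFiniteMeasure ν] :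
    klDiv (μ.map Prod.swap) (ν.map Prod.swap) = klDiv μ ν := by
  refine le_antisymm (klDiv_map_le _ _ measurable_swap) ?_
  have h (ξ : Measure (A × B)) : ξ = (ξ.map Prod.swap).map Prod.swap := by
    rw [Measure.map_map measurable_swap measurable_swap]; simp
  conv_lhs => rw [h μ, h ν]
  exact klDiv_map_le _ _ measurable_swap

/-- Among all product laws with first marginal `μ`, the divergence from a joint law is smallest
when the second factor is the second marginal of the joint law: the excess is the divergence of
the marginals. -/
theorem klDiv_prod_snd_le (μ : Measure A) [IsProbabilityMeasure μ] (ν : Measure B)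
    [IsProbabilityMeasure ν] (J : Measure (A × B)) [IsProbabilityMeasure J] :
    klDiv J (μ.prod J.snd) ≤ klDiv J (μ.prod ν) := by
  by_cases h : J ≪ μ.prod ν
  · obtain ⟨ρ, hρ, hJ⟩ := exists_kernel_swap_eq_compProd μ ν J h
    rw [← klDiv_map_swap J, ← klDiv_map_swap J (μ.prod ν), Measure.prod_swap, Measure.prod_swap,
      hJ, ← Measure.compProd_const, ← Measure.compProd_const,
      klDiv_compProd_eq_add J.snd ν]
    exact le_add_self
  · rw [klDiv_of_not_ac h]
    exact le_top

/-- A bounded density ratio bounds the divergence. -/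
theorem klDiv_le_log_of_le_smul (p q : Measure A) [IsProbabilityMeasure p]
    [IsProbabilityMeasure q] {c : ℝ} (h : p ≤ ENNReal.ofReal c • q) :
    klDiv p q ≤ ENNReal.ofReal (Real.log c) := by
  have hac : p ≪ q := (Measure.absolutelyContinuous_of_le h).trans
    Measure.smul_absolutelyContinuous
  have hr : ∀ᵐ x ∂q, p.rnDeriv q x ≤ ENNReal.ofReal c := by
    refine ae_le_of_forall_setLIntegral_le_of_sigmaFinite (Measure.measurable_rnDeriv p q)
      fun s _ _ => ?_
    rw [Measure.setLIntegral_rnDeriv hac, setLIntegral_const]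
    exact h s
  have hint : Integrable (fun x => (p.rnDeriv q x).toReal) q := Measure.integrable_toReal_rnDeriv
  rw [klDiv_eq_lintegral_klFun_of_ac hac]
  have hle : ∀ᵐ x ∂q, klFun (p.rnDeriv q x).toReal ≤
      (p.rnDeriv q x).toReal * Real.log c + (1 - (p.rnDeriv q x).toReal) := by
    filter_upwards [hr] with x hx
    rw [klFun_apply]
    have h1 : (p.rnDeriv q x).toReal ≤ max c 0 := by
      rw [← ENNReal.toReal_ofReal']
      exact ENNReal.toReal_mono ENNReal.ofReal_ne_top hx
    rcases ENNReal.toReal_nonneg (a := p.rnDeriv q x) |>.eq_or_lt with h0 | h0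
    · rw [← h0]; simp
    · have h2 : (p.rnDeriv q x).toReal ≤ c := by
        rcases le_max_iff.1 h1 with h3 | h3
        · exact h3
        · linarith
      have := mul_le_mul_of_nonneg_left (Real.log_le_log h0 h2) h0.le
      linarith
  calc ∫⁻ x, ENNReal.ofReal (klFun (p.rnDeriv q x).toReal) ∂q
      ≤ ∫⁻ x, ENNReal.ofReal
          ((p.rnDeriv q x).toReal * Real.log c + (1 - (p.rnDeriv q x).toReal)) ∂q :=
        lintegral_mono_ae (hle.mono fun x hx => ENNReal.ofReal_le_ofReal hx)
    _ = ENNReal.ofReal (∫ x,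
          ((p.rnDeriv q x).toReal * Real.log c + (1 - (p.rnDeriv q x).toReal)) ∂q) := by
        refine (ofReal_integral_eq_lintegral_ofReal
          ((hint.mul_const _).add ((integrable_const _).sub hint)) ?_).symm
        filter_upwards [hle] with x hx
        exact (klFun_nonneg ENNReal.toReal_nonneg).trans hx
    _ = ENNReal.ofReal (Real.log c) := by
        have hsub : Integrable (fun x => 1 - (p.rnDeriv q x).toReal) q :=
          (integrable_const _).sub hint
        rw [integral_add (hint.mul_const _) hsub,
          integral_sub (integrable_const _) hint, integral_mul_const,
          Measure.integral_toReal_rnDeriv hac]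
        simp

theorem klDiv_le_log_of_forall_singleton [Countable A] [MeasurableSingletonClass A]
    (p q : Measure A) [IsProbabilityMeasure p] [IsProbabilityMeasure q] {c : ℝ}
    (h : ∀ a, p {a} ≤ ENNReal.ofReal c * q {a}) :
    klDiv p q ≤ ENNReal.ofReal (Real.log c) := by
  refine klDiv_le_log_of_le_smul p q (Measure.le_iff.2 fun s _ => ?_)
  rw [← Measure.tsum_indicator_apply_singleton p s s.to_countable.measurableSet,
    ← Measure.tsum_indicator_apply_singleton _ s s.to_countable.measurableSet]
  refine ENNReal.tsum_le_tsum fun a => ?_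
  by_cases ha : a ∈ s
  · simpa [ha] using h a
  · simp [ha]

theorem klDiv_comp_le [MeasurableSpace.CountableOrCountablyGenerated A B]
    (p q : Measure A) [IsFiniteMeasure p] [IsFiniteMeasure q] (κ η : Kernel A B)
    [IsMarkovKernel κ] [IsMarkovKernel η] :
    klDiv (κ ∘ₘ p) (η ∘ₘ q) ≤ klDiv p q + ∫⁻ a, klDiv (κ a) (η a) ∂p := by
  rw [← klDiv_compProd_right_eq_lintegral, ← klDiv_compProd_eq_add, ← Measure.snd_compProd,
    ← Measure.snd_compProd]
  exact klDiv_map_le _ _ measurable_snd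

/-- The mixture of finitely many measures with equal weights. -/
noncomputable def uniformMixture {ι : Type*} [Fintype ι] (ν : ι → Measure A) : Measure A :=
  (Fintype.card ι : ℝ≥0∞)⁻¹ • ∑ i, ν i

instance {ι : Type*} [Fintype ι] [Nonempty ι] (ν : ι → Measure A)
    [∀ i, IsProbabilityMeasure (ν i)] : IsProbabilityMeasure (uniformMixture ν) := ⟨by
  simp only [uniformMixture, Measure.smul_apply, Measure.coe_finsetSum, Finset.sum_apply,
    measure_univ, Finset.sum_const, Finset.card_univ, nsmul_eq_mul, mul_one, smul_eq_mul]
  exact ENNReal.inv_mul_cancel (by simp) (by simp)⟩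

theorem klDiv_uniformMixture_dirac_le {ι : Type*} [Fintype ι] [Nonempty ι] [MeasurableSpace ι]
    [MeasurableSingletonClass ι] (p : Measure ι) [IsProbabilityMeasure p] :
    klDiv p (uniformMixture Measure.dirac) ≤ ENNReal.ofReal (Real.log (Fintype.card ι)) := by
  classical
  refine klDiv_le_log_of_forall_singleton _ _ fun a => ?_
  have hcard : (Fintype.card ι : ℝ≥0∞) * (Fintype.card ι : ℝ≥0∞)⁻¹ = 1 :=
    ENNReal.mul_inv_cancel (by simp) (by simp)
  have hua : (uniformMixture Measure.dirac : Measure ι) {a} = (Fintype.card ι : ℝ≥0∞)⁻¹ := by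
    rw [uniformMixture, Measure.smul_apply, Measure.coe_finsetSum, Finset.sum_apply]
    simp [Set.indicator]
  rw [hua, ENNReal.ofReal_natCast, hcard]
  exact prob_le_one

/-- Replacing a model by an equal-weight mixture that contains it costs the code length
`log |ι|` of its index. This is the chain rule for the pair (index, sample), where the index is
deterministic under the first law. -/
theorem klDiv_uniformMixture_le {ι : Type*} [Fintype ι] (μ : Measure A) [IsProbabilityMeasure μ]
    (ν : ι → Measure A) [∀ i, IsProbabilityMeasure (ν i)] (i : ι) :
    klDiv μ (uniformMixture ν) ≤
      klDiv μ (ν i) + ENNReal.ofReal (Real.log (Fintype.card ι)) := by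
  classical
  let _ : MeasurableSpace ι := ⊤
  have : Nonempty ι := ⟨i⟩
  let k : Kernel ι A := ⟨ν, Measurable.of_discrete⟩
  have : IsMarkovKernel k := ⟨fun j => inferInstanceAs (IsProbabilityMeasure (ν j))⟩
  set u : Measure ι := uniformMixture Measure.dirac with hu
  have h1 : (Kernel.const ι μ) ∘ₘ Measure.dirac i = μ := by simp
  have h2 : k ∘ₘ u = uniformMixture ν := by
    ext s hs
    rw [Measure.bind_apply hs k.aemeasurable, hu, uniformMixture, uniformMixture,
      lintegral_smul_measure, lintegral_finsetSum_measure]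
    simp [k]
  calc klDiv μ (uniformMixture ν)
      = klDiv ((Kernel.const ι μ) ∘ₘ Measure.dirac i) (k ∘ₘ u) := by rw [h1, h2]
    _ ≤ klDiv (Measure.dirac i) u +
          ∫⁻ a, klDiv (Kernel.const ι μ a) (k a) ∂(Measure.dirac i) := klDiv_comp_le _ _ _ _
    _ ≤ klDiv μ (ν i) + ENNReal.ofReal (Real.log (Fintype.card ι)) := by
        rw [lintegral_dirac, add_comm]
        exact add_le_add le_rfl (klDiv_uniformMixture_dirac_le _)

/-- Subadditivity over independent pairs; no integrability or absolute continuity is needed. -/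
theorem klDiv_prod_le (μ μ' : Measure A) (ν ν' : Measure B) [IsProbabilityMeasure μ]
    [IsProbabilityMeasure μ'] [IsProbabilityMeasure ν] [IsProbabilityMeasure ν'] :
    klDiv (μ.prod ν) (μ'.prod ν') ≤ klDiv μ μ' + klDiv ν ν' := by
  rw [← Measure.compProd_const, ← Measure.compProd_const, klDiv_compProd_eq_add]
  gcongr
  rw [Measure.compProd_const, Measure.compProd_const, ← klDiv_map_swap, Measure.prod_swap,
    Measure.prod_swap, ← Measure.compProd_const, ← Measure.compProd_const, klDiv_compProd_left]

theorem klDiv_pi_le (μ ν : Measure A) [IsProbabilityMeasure μ] [IsProbabilityMeasure ν] (N : ℕ) :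
    klDiv (Measure.pi fun _ : Fin N => μ) (Measure.pi fun _ : Fin N => ν) ≤ N * klDiv μ ν := by
  induction N with
  | zero => rw [Measure.pi_of_empty, Measure.pi_of_empty]; simp
  | succ n ih =>
    have h (ξ : Measure A) [IsProbabilityMeasure ξ] :
        Measure.pi (fun _ : Fin (n + 1) => ξ) = (ξ.prod (Measure.pi fun _ : Fin n => ξ)).map
          (MeasurableEquiv.piFinSuccAbove (fun _ => A) 0).symm :=
      ((measurePreserving_piFinSuccAbove (fun _ : Fin (n + 1) => ξ) 0).symm).map_eq.symm
    rw [h μ, h ν]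
    refine (klDiv_map_le _ _ (MeasurableEquiv.measurable _)).trans
      ((klDiv_prod_le _ _ _ _).trans ?_)
    rw [Nat.cast_succ, add_mul, one_mul, add_comm]
    gcongr

end Divergence

/-! ### Redundancy and mutual information -/

section Redundancy

variable {Θ S : Type*} [MeasurableSpace Θ] [MeasurableSpace S]

theorem lintegral_klDiv_const_eq [MeasurableSpace.CountablyGenerated S] (prior : Measure Θ)
    [IsProbabilityMeasure prior] (κ : Kernel Θ S) [IsMarkovKernel κ] (M : Measure S)
    [IsProbabilityMeasure M] :
    ∫⁻ θ, klDiv (κ θ) M ∂prior = klDiv (prior ⊗ₘ κ) (prior.prod M) := by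
  rw [← Measure.compProd_const, klDiv_compProd_right_eq_lintegral]
  rfl

theorem mutualInfo_le_lintegral_klDiv [MeasurableSpace.CountablyGenerated S] (prior : Measure Θ)
    [IsProbabilityMeasure prior] (κ : Kernel Θ S) [IsMarkovKernel κ] (M : Measure S)
    [IsProbabilityMeasure M] :
    mutualInfo prior κ ≤ ∫⁻ θ, klDiv (κ θ) M ∂prior := by
  rw [lintegral_klDiv_const_eq, mutualInfo, ← Measure.snd_compProd]
  exact klDiv_prod_snd_le prior M _

/-- The Bayes mixture attains the least Bayesian redundancy, which is the mutual information. -/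
theorem iInf_bayesRedundancy_div (prior : Measure Θ) [IsProbabilityMeasure prior]
    (κ : Kernel Θ S) [IsMarkovKernel κ] [StandardBorelSpace S] (N : ℕ) :
    (⨅ M : ProbabilityMeasure (Fin N → S), bayesRedundancy prior κ N M / (N : ℝ≥0∞)) =
      mutualInfo prior (iidKernel κ N) / (N : ℝ≥0∞) := by
  refine le_antisymm ?_ (le_iInf fun M => ?_)
  · refine (iInf_le _ ⟨iidKernel κ N ∘ₘ prior, inferInstance⟩).trans (le_of_eq ?_)
    congr 1
    exact lintegral_klDiv_const_eq prior (iidKernel κ N) (iidKernel κ N ∘ₘ prior)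
  · gcongr
    exact mutualInfo_le_lintegral_klDiv prior (iidKernel κ N) _

end Redundancy

/-! ### Occupied tables and late tables in the Chinese Restaurant Process -/

section Restaurant

/-- The seating history of the customers `0, …, n`. -/
abbrev history (n : ℕ) (ω : ℕ → ℕ) : Finset.Iic n → ℕ :=
  Preorder.frestrictLe (π := fun _ : ℕ => ℕ) n ω

theorem measurable_history (n : ℕ) : Measurable (history n) :=
  Preorder.measurable_frestrictLe (X := fun _ : ℕ => ℕ) n

/-- The number of customers of the history `h` who sit at a table outside `A`. -/
def countOutside {n : ℕ} (A : Finset ℕ) (h : Finset.Iic n → ℕ) : ℕ :=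
  (Finset.univ.filter fun i => h i ∉ A).card

theorem occupied_history (n : ℕ) (ω : ℕ → ℕ) :
    occupied (history n ω) = (Finset.range (n + 1)).image ω := by
  ext k
  simp only [occupied, Finset.mem_image, Finset.mem_univ, true_and, Finset.mem_range]
  constructor
  · rintro ⟨i, hi⟩
    exact ⟨i, Nat.lt_succ_of_le (Finset.mem_Iic.1 i.2), hi⟩
  · rintro ⟨i, hi, hk⟩
    exact ⟨⟨i, Finset.mem_Iic.2 (Nat.le_of_lt_succ hi)⟩, hk⟩

theorem countOutside_history (n : ℕ) (A : Finset ℕ) (ω : ℕ → ℕ) :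
    countOutside A (history n ω) = ((Finset.range (n + 1)).filter fun i => ω i ∉ A).card := by
  refine Finset.card_bij (fun i _ => (i : ℕ)) ?_ ?_ ?_
  · intro i hi
    have := Finset.mem_Iic.1 i.2
    simp only [Finset.mem_filter, Finset.mem_univ, true_and] at hi
    simp only [Finset.mem_filter, Finset.mem_range]
    exact ⟨by omega, hi⟩
  · intro i _ j _ h
    exact Subtype.ext h
  · intro i hi
    simp only [Finset.mem_filter, Finset.mem_range] at hi
    refine ⟨⟨i, Finset.mem_Iic.2 (by omega)⟩, ?_, rfl⟩
    simp only [Finset.mem_filter, Finset.mem_univ, true_and]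
    exact hi.2

theorem freshTable_notMem {n : ℕ} (h : Finset.Iic n → ℕ) : freshTable h ∉ occupied h := by
  have hne : {k : ℕ | k ∉ occupied h}.Nonempty := by
    obtain ⟨k, hk⟩ := Infinite.exists_notMem_finset (occupied h)
    exact ⟨k, hk⟩
  exact Nat.sInf_mem hne

theorem sum_tableCount_sdiff {n : ℕ} (h : Finset.Iic n → ℕ) (A : Finset ℕ) :
    ∑ k ∈ occupied h \ A, tableCount h k = countOutside A h := by
  have := Finset.card_eq_sum_card_fiberwise (f := h) (s := Finset.univ.filter fun i => h i ∉ A)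
    (t := occupied h \ A) (fun i hi => by
      simp only [Finset.coe_filter, Finset.mem_univ, true_and, Set.mem_ofPred_eq] at hi
      simp [hi, occupied])
  rw [countOutside, this]
  refine Finset.sum_congr rfl fun k hk => ?_
  rw [tableCount, Finset.filter_filter]
  congr 1
  ext i
  simp only [Finset.mem_filter, Finset.mem_univ, true_and]
  constructor
  · rintro rfl
    exact ⟨(Finset.mem_sdiff.1 hk).2, rfl⟩
  · exact fun h => h.2

namespace PYParam

variable (P : PYParam)

theorem den_pos (n : ℕ) : 0 < (n : ℝ) + 1 + P.β := by
  have h1 := P.α_lt_one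
  have h2 := P.neg_α_lt_β
  have : (0 : ℝ) ≤ n := Nat.cast_nonneg n
  linarith

theorem add_mul_card_nonneg {K : ℝ} (hK : 1 ≤ K) : 0 ≤ P.β + P.α * K := by
  have h0 := P.zero_le_α
  have h2 := P.neg_α_lt_β
  nlinarith

end PYParam

theorem one_le_card_occupied {n : ℕ} (h : Finset.Iic n → ℕ) :
    (1 : ℝ) ≤ ((occupied h).card : ℝ) := by
  exact_mod_cast Finset.card_pos.2 (occupied_nonempty h)

/-- The probability that the next customer avoids a given set `A` of occupied tables. -/
theorem seatMeasure_compl (P : PYParam) {n : ℕ} (h : Finset.Iic n → ℕ) {A : Finset ℕ}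
    (hA : A ⊆ occupied h) :
    seatMeasure P h {k | k ∉ A} =
      ENNReal.ofReal (((countOutside A h : ℝ) + (P.β + P.α * (A.card : ℝ))) /
        ((n : ℝ) + 1 + P.β)) := by
  classical
  have hden := P.den_pos n
  have hpos : ∀ k ∈ occupied h \ A, 0 ≤ ((tableCount h k : ℝ) - P.α) / ((n : ℝ) + 1 + P.β) := by
    intro k hk
    have : (1 : ℝ) ≤ (tableCount h k : ℝ) := by
      exact_mod_cast one_le_tableCount h (Finset.mem_sdiff.1 hk).1
    exact div_nonneg (by linarith [P.α_lt_one]) hden.le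
  have hfresh : freshTable h ∉ A := fun hm => freshTable_notMem h (hA hm)
  have hsum : (∑ k ∈ occupied h \ A, (tableCount h k : ℝ)) = countOutside A h := by
    exact_mod_cast sum_tableCount_sdiff h A
  have hcard : ((occupied h \ A).card : ℝ) = (occupied h).card - A.card := by
    rw [Finset.card_sdiff_of_subset hA, Nat.cast_sub (Finset.card_le_card hA)]
  simp only [seatMeasure, Measure.add_apply, Measure.coe_finsetSum, Finset.sum_apply,
    Measure.smul_apply, smul_eq_mul]
  have h1 : (Measure.dirac (freshTable h)) {k | k ∉ A} = 1 := by simp [hfresh]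
  have h2 : ∑ k ∈ occupied h, ENNReal.ofReal (((tableCount h k : ℝ) - P.α) /
      ((n : ℝ) + 1 + P.β)) * (Measure.dirac k) {k | k ∉ A} =
      ∑ k ∈ occupied h \ A, ENNReal.ofReal (((tableCount h k : ℝ) - P.α) /
      ((n : ℝ) + 1 + P.β)) := by
    rw [Finset.sdiff_eq_filter, Finset.sum_filter]
    refine Finset.sum_congr rfl fun k _ => ?_
    by_cases hk : k ∈ A <;> simp [hk]
  rw [h1, h2, mul_one, ← ENNReal.ofReal_sum_of_nonneg hpos, ← ENNReal.ofReal_add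
    (Finset.sum_nonneg hpos)
    (div_nonneg (P.add_mul_card_nonneg (one_le_card_occupied h)) hden.le), ← Finset.sum_div,
    Finset.sum_sub_distrib, hsum, ← add_div, Finset.sum_const, nsmul_eq_mul, hcard]
  congr 2
  ring

/-- The seating rule as a one-step expectation. -/
theorem lintegral_crp_succ (P : PYParam) (n : ℕ) (f : (Finset.Iic n → ℕ) → ℕ → ℝ≥0∞) :
    ∫⁻ ω, f (history n ω) (ω (n + 1)) ∂(crp P) =
      ∫⁻ ω, ∫⁻ k, f (history n ω) k ∂(seatMeasure P (history n ω)) ∂(crp P) := by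
  have key := Kernel.map_frestrictLe_trajMeasure_compProd_eq_map_trajMeasure
    (X := fun _ : ℕ => ℕ) (κ := seatKernel P) (μ₀ := Measure.dirac 0) (a := n)
  have hf : Measurable fun p : (Finset.Iic n → ℕ) × ℕ => f p.1 p.2 := Measurable.of_discrete
  have hm : Measurable fun ω : ℕ → ℕ => (history n ω, ω (n + 1)) :=
    (measurable_history n).prodMk (measurable_pi_apply (n + 1))
  calc ∫⁻ ω, f (history n ω) (ω (n + 1)) ∂(crp P)
      = ∫⁻ p, f p.1 p.2 ∂((crp P).map fun ω => (history n ω, ω (n + 1))) :=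
        (lintegral_map hf hm).symm
    _ = ∫⁻ p, f p.1 p.2 ∂((crp P).map (history n) ⊗ₘ seatKernel P n) := by
        rw [crp]; exact congrArg (fun μ => ∫⁻ p, f p.1 p.2 ∂μ) key.symm
    _ = ∫⁻ h, ∫⁻ k, f h k ∂(seatMeasure P h) ∂((crp P).map (history n)) :=
        Measure.lintegral_compProd hf
    _ = _ := lintegral_map Measurable.of_discrete (measurable_history n)

/-- The tables occupied by the customers `0, …, n`. -/
abbrev tables (n : ℕ) (ω : ℕ → ℕ) : Finset ℕ := occupied (history n ω)

theorem tables_succ (n : ℕ) (ω : ℕ → ℕ) : tables (n + 1) ω = insert (ω (n + 1)) (tables n ω) := by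
  rw [tables, tables, occupied_history, occupied_history, Finset.range_add_one,
    Finset.image_insert]

theorem measurable_comp_history {B : Type*} [MeasurableSpace B] {n : ℕ}
    (g : (Finset.Iic n → ℕ) → B) : Measurable fun ω => g (history n ω) :=
  (Measurable.of_discrete (f := g)).comp (measurable_history n)

theorem lintegral_ite_notMem (P : PYParam) (n : ℕ) (A : (Finset.Iic n → ℕ) → Finset ℕ)
    (hA : ∀ h, A h ⊆ occupied h) :
    ∫⁻ ω, (if ω (n + 1) ∉ A (history n ω) then 1 else 0) ∂(crp P) =
      ∫⁻ ω, ENNReal.ofReal (((countOutside (A (history n ω)) (history n ω) : ℝ) +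
        (P.β + P.α * ((A (history n ω)).card : ℝ))) / ((n : ℝ) + 1 + P.β)) ∂(crp P) := by
  rw [lintegral_crp_succ P n fun h k => if k ∉ A h then 1 else 0]
  refine lintegral_congr fun ω => ?_
  rw [← seatMeasure_compl P _ (hA _), ← lintegral_indicator_one (MeasurableSet.of_discrete)]
  exact lintegral_congr fun k => by simp [Set.indicator]

theorem countOutside_occupied {n : ℕ} (h : Finset.Iic n → ℕ) : countOutside (occupied h) h = 0 := by
  simp [countOutside, occupied]

/-- The expected number of occupied tables grows at a rate of at most
`α E[K] / (n + 1 + β) + |β| / (n + 1 + β)`. -/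
theorem lintegral_card_tables_succ_le (P : PYParam) (n : ℕ) :
    ∫⁻ ω, ((tables (n + 1) ω).card : ℝ≥0∞) ∂(crp P) ≤
      ENNReal.ofReal (1 + P.α / ((n : ℝ) + 1 + P.β)) * ∫⁻ ω, ((tables n ω).card : ℝ≥0∞) ∂(crp P) +
        ENNReal.ofReal (|P.β| / ((n : ℝ) + 1 + P.β)) := by
  have hden := P.den_pos n
  have h0 := P.zero_le_α
  have hstep : ∀ ω, ((tables (n + 1) ω).card : ℝ≥0∞) =
      ((tables n ω).card : ℝ≥0∞) + if ω (n + 1) ∉ occupied (history n ω) then 1 else 0 := by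
    intro ω
    rw [tables_succ]
    by_cases h : ω (n + 1) ∈ tables n ω
    · rw [Finset.insert_eq_of_mem h, if_neg (not_not.2 h), add_zero]
    · rw [Finset.card_insert_of_notMem h, if_pos h, Nat.cast_succ]
  simp_rw [hstep]
  have hm : Measurable fun ω => ((tables n ω).card : ℝ≥0∞) :=
    measurable_comp_history fun h => ((occupied h).card : ℝ≥0∞)
  rw [lintegral_add_left hm, lintegral_ite_notMem P n occupied fun _ => subset_rfl,
    ENNReal.ofReal_add zero_le_one (div_nonneg h0 hden.le), ENNReal.ofReal_one, add_mul, one_mul,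
    add_assoc (lintegral _ _)]
  gcongr
  calc _ ≤ ∫⁻ ω, (ENNReal.ofReal (P.α / ((n : ℝ) + 1 + P.β)) * ((tables n ω).card : ℝ≥0∞) +
          ENNReal.ofReal (|P.β| / ((n : ℝ) + 1 + P.β))) ∂(crp P) := by
        refine lintegral_mono fun ω => ?_
        rw [← ENNReal.ofReal_natCast, ← ENNReal.ofReal_mul (div_nonneg h0 hden.le),
          ← ENNReal.ofReal_add (mul_nonneg (div_nonneg h0 hden.le) (Nat.cast_nonneg _))
            (div_nonneg (abs_nonneg _) hden.le)]
        refine ENNReal.ofReal_le_ofReal ?_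
        rw [countOutside_occupied, div_mul_eq_mul_div, ← add_div]
        refine div_le_div_of_nonneg_right ?_ hden.le
        rw [Nat.cast_zero, zero_add]
        linarith [le_abs_self P.β]
    _ = _ := by
        rw [lintegral_add_right _ measurable_const, lintegral_const_mul _ hm]
        simp

/-- The harmonic sums of the seating rule are logarithmic. -/
theorem sum_inv_den_le (P : PYParam) (n : ℕ) :
    ∑ k ∈ Finset.Ico 0 n, 1 / ((k : ℝ) + 1 + P.β) ≤
      1 / (1 + P.β) + 1 + Real.log ((n : ℝ) + 1) := by
  have hβ : 0 < 1 + P.β := by simpa using P.den_pos 0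
  have hH : ∀ m : ℕ, ∑ k ∈ Finset.range m, 1 / (((k + 1 : ℕ) : ℝ) + 1 + P.β) ≤
      1 + Real.log ((m : ℝ) + 1) := by
    intro m
    calc ∑ k ∈ Finset.range m, 1 / (((k + 1 : ℕ) : ℝ) + 1 + P.β)
        ≤ ∑ k ∈ Finset.range m, ((k : ℝ) + 1)⁻¹ := by
          refine Finset.sum_le_sum fun k _ => ?_
          rw [one_div]
          refine inv_anti₀ (by positivity) ?_
          push_cast
          linarith
      _ = ((harmonic m : ℚ) : ℝ) := by simp [harmonic]
      _ ≤ 1 + Real.log m := harmonic_le_one_add_log m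
      _ ≤ 1 + Real.log ((m : ℝ) + 1) := by
          rcases m.eq_zero_or_pos with rfl | hm
          · simp
          · gcongr
            linarith
  rw [← Finset.range_eq_Ico]
  cases n with
  | zero =>
    simp only [Finset.range_zero, Finset.sum_empty, Nat.cast_zero, zero_add, Real.log_one, add_zero]
    positivity
  | succ m =>
    rw [Finset.sum_range_succ']
    have h1 := hH m
    have h2 : Real.log ((m : ℝ) + 1) ≤ Real.log (((m + 1 : ℕ) : ℝ) + 1) := by
      gcongr
      exact Nat.le_succ m
    simp only [Nat.cast_zero, zero_add]
    linarith

/-- The expected number of tables occupied by `n + 1` customers is at most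
`C (n + 1) ^ α (1 + log (n + 1))`. -/
theorem exists_lintegral_card_tables_le (P : PYParam) :
    ∃ C : ℝ, 0 < C ∧ ∀ n : ℕ, ∫⁻ ω, ((tables n ω).card : ℝ≥0∞) ∂(crp P) ≤
      ENNReal.ofReal (C * (((n : ℝ) + 1) ^ P.α * (1 + Real.log ((n : ℝ) + 1)))) := by
  have h0 := P.zero_le_α
  have hβ : 0 < 1 + P.β := by simpa using P.den_pos 0
  set c₀ : ℝ := 1 / (1 + P.β) + 1 with hc₀
  have hc₀1 : 1 ≤ c₀ := by rw [hc₀]; linarith [one_div_pos.2 hβ]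
  set c : ℕ → ℝ := fun k => P.α / ((k : ℝ) + 1 + P.β) with hc
  set b : ℕ → ℝ := fun k => |P.β| / ((k : ℝ) + 1 + P.β) with hb
  have hcn : ∀ k, 0 ≤ c k := fun k => div_nonneg h0 (P.den_pos k).le
  have hbn : ∀ k, 0 ≤ b k := fun k => div_nonneg (abs_nonneg _) (P.den_pos k).le
  let u : ℕ → ℝ := fun n => Nat.rec 1 (fun k x => (1 + c k) * x + b k) n
  have hu1 : ∀ n, u (n + 1) = (1 + c n) * u n + b n := fun n => rfl
  have hun : ∀ n, 0 ≤ u n := by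
    intro n
    induction n with
    | zero => exact zero_le_one
    | succ k ih => rw [hu1]; have := hcn k; have := hbn k; positivity
  have hle : ∀ n, ∫⁻ ω, ((tables n ω).card : ℝ≥0∞) ∂(crp P) ≤ ENNReal.ofReal (u n) := by
    intro n
    induction n with
    | zero =>
      have : ∀ ω, ((tables 0 ω).card : ℝ≥0∞) = 1 := by
        intro ω
        rw [tables, occupied_history]
        simp
      simp_rw [this]
      simp [u]
    | succ k ih =>
      refine (lintegral_card_tables_succ_le P k).trans ?_
      have := hcn k
      rw [hu1, ENNReal.ofReal_add (mul_nonneg (by positivity) (hun k)) (hbn k),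
        ENNReal.ofReal_mul (by positivity)]
      gcongr
  refine ⟨(1 + |P.β| * c₀) * Real.exp (P.α * c₀), by positivity, fun n => (hle n).trans ?_⟩
  refine ENNReal.ofReal_le_ofReal ?_
  have hlog : 0 ≤ Real.log ((n : ℝ) + 1) := Real.log_nonneg (by linarith [n.cast_nonneg (α := ℝ)])
  have hn1 : (0 : ℝ) < (n : ℝ) + 1 := by positivity
  have hgron := discrete_gronwall (u := u) (b := b) (c := c) (n₀ := 0) (hun 0)
    (fun n _ => (hu1 n).le) (fun n _ => hcn n) (fun n _ => hbn n) (Nat.zero_le n)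
  have hcsum : ∑ k ∈ Finset.Ico 0 n, c k ≤ P.α * (c₀ + Real.log ((n : ℝ) + 1)) := by
    calc ∑ k ∈ Finset.Ico 0 n, c k = P.α * ∑ k ∈ Finset.Ico 0 n, 1 / ((k : ℝ) + 1 + P.β) := by
          rw [Finset.mul_sum]; simp [hc, div_eq_mul_inv]
      _ ≤ _ := mul_le_mul_of_nonneg_left (sum_inv_den_le P n) h0
  have hbsum : ∑ k ∈ Finset.Ico 0 n, b k ≤ |P.β| * (c₀ + Real.log ((n : ℝ) + 1)) := by
    calc ∑ k ∈ Finset.Ico 0 n, b k = |P.β| * ∑ k ∈ Finset.Ico 0 n, 1 / ((k : ℝ) + 1 + P.β) := by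
          rw [Finset.mul_sum]; simp [hb, div_eq_mul_inv]
      _ ≤ _ := mul_le_mul_of_nonneg_left (sum_inv_den_le P n) (abs_nonneg _)
  have hexp : Real.exp (P.α * (c₀ + Real.log ((n : ℝ) + 1))) =
      Real.exp (P.α * c₀) * ((n : ℝ) + 1) ^ P.α := by
    rw [mul_add, Real.exp_add, Real.rpow_def_of_pos hn1, mul_comm (Real.log _)]
  have hu0 : u 0 = 1 := rfl
  have h1 : 1 + |P.β| * (c₀ + Real.log ((n : ℝ) + 1)) ≤
      (1 + |P.β| * c₀) * (1 + Real.log ((n : ℝ) + 1)) := by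
    have : |P.β| * Real.log ((n : ℝ) + 1) ≤ |P.β| * Real.log ((n : ℝ) + 1) * c₀ :=
      le_mul_of_one_le_right (by positivity) hc₀1
    nlinarith
  calc u n ≤ (u 0 + ∑ k ∈ Finset.Ico 0 n, b k) * Real.exp (∑ k ∈ Finset.Ico 0 n, c k) := hgron
    _ ≤ ((1 + |P.β| * c₀) * (1 + Real.log ((n : ℝ) + 1))) *
          (Real.exp (P.α * c₀) * ((n : ℝ) + 1) ^ P.α) := by
        rw [← hexp, hu0]
        gcongr
        linarith
    _ = _ := by ring

/-- The number of customers among `0, …, n` whose table was not yet occupied at time `m`. -/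
def lateCount (m n : ℕ) (ω : ℕ → ℕ) : ℕ :=
  ((Finset.range (n + 1)).filter fun i => ω i ∉ tables m ω).card

theorem measurableSet_notMem_tables (m i : ℕ) : MeasurableSet {ω : ℕ → ℕ | ω i ∉ tables m ω} := by
  have : {ω : ℕ → ℕ | ω i ∉ tables m ω} = ⋂ j ∈ Finset.range (m + 1), {ω | ω j = ω i}ᶜ := by
    ext ω
    rw [Set.mem_ofPred_eq, tables, occupied_history]
    simp
  rw [this]
  exact Finset.measurableSet_biInter _ fun j _ =>
    (measurableSet_eq_fun (measurable_pi_apply j) (measurable_pi_apply i)).compl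

theorem natCast_lateCount (m n : ℕ) (ω : ℕ → ℕ) : (lateCount m n ω : ℝ≥0∞) =
    ∑ i ∈ Finset.range (n + 1), if ω i ∉ tables m ω then 1 else 0 := by
  rw [lateCount, Finset.card_filter]
  push_cast
  rfl

theorem measurable_lateCount (m n : ℕ) : Measurable fun ω => (lateCount m n ω : ℝ≥0∞) := by
  simp_rw [natCast_lateCount]
  exact Finset.measurable_sum _ fun i _ =>
    Measurable.ite (measurableSet_notMem_tables m i) measurable_const measurable_const

theorem lateCount_self (m : ℕ) (ω : ℕ → ℕ) : lateCount m m ω = 0 := by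
  rw [lateCount, ← countOutside_history, countOutside_occupied]

/-- `lateCount m n + β + α K`, with `K` the number of tables at time `m`, grows in expectation
exactly like `n + 1 + β`: the tables opened after time `m` form a Pólya urn colour. -/
theorem lintegral_lateCount_add_le (P : PYParam) {m n : ℕ} (hmn : m ≤ n) :
    ∫⁻ ω, ((lateCount m n ω : ℝ≥0∞) +
        ENNReal.ofReal (P.β + P.α * ((tables m ω).card : ℝ))) ∂(crp P) ≤
      ENNReal.ofReal (((n : ℝ) + 1 + P.β) / ((m : ℝ) + 1 + P.β)) *
        ∫⁻ ω, ENNReal.ofReal (P.β + P.α * ((tables m ω).card : ℝ)) ∂(crp P) := by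
  have hm := P.den_pos m
  have hw : Measurable fun ω => ENNReal.ofReal (P.β + P.α * ((tables m ω).card : ℝ)) :=
    measurable_comp_history fun h => ENNReal.ofReal (P.β + P.α * ((occupied h).card : ℝ))
  induction n, hmn using Nat.le_induction with
  | base =>
    simp_rw [lateCount_self]
    rw [div_self hm.ne']
    simp
  | succ n hmn ih =>
    have hn := P.den_pos n
    let A : (Finset.Iic n → ℕ) → Finset ℕ := fun h =>
      occupied (Preorder.frestrictLe₂ (π := fun _ : ℕ => ℕ) hmn h)
    have hAt : ∀ ω, A (history n ω) = tables m ω := fun ω => rfl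
    have hA : ∀ h, A h ⊆ occupied h := by
      intro h k hk
      obtain ⟨i, -, hi⟩ := Finset.mem_image.1 hk
      exact Finset.mem_image.2 ⟨_, Finset.mem_univ _, hi⟩
    have hstep : ∀ ω, (lateCount m (n + 1) ω : ℝ≥0∞) =
        (lateCount m n ω : ℝ≥0∞) + if ω (n + 1) ∉ A (history n ω) then 1 else 0 := by
      intro ω
      rw [natCast_lateCount, natCast_lateCount, Finset.sum_range_succ _ (n + 1)]
      rfl
    have hnext := lintegral_ite_notMem P n A hA
    have hcond : ∀ ω, ENNReal.ofReal (((countOutside (A (history n ω)) (history n ω) : ℝ) +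
        (P.β + P.α * ((A (history n ω)).card : ℝ))) / ((n : ℝ) + 1 + P.β)) =
        ENNReal.ofReal (1 / ((n : ℝ) + 1 + P.β)) * ((lateCount m n ω : ℝ≥0∞) +
        ENNReal.ofReal (P.β + P.α * ((tables m ω).card : ℝ))) := by
      intro ω
      have hc := P.add_mul_card_nonneg (one_le_card_occupied (history m ω))
      rw [← ENNReal.ofReal_natCast, ← ENNReal.ofReal_add (Nat.cast_nonneg _) hc,
        ← ENNReal.ofReal_mul (by positivity), hAt, countOutside_history, lateCount]
      congr 1
      ring
    set D := ∫⁻ ω, ((lateCount m n ω : ℝ≥0∞) +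
        ENNReal.ofReal (P.β + P.α * ((tables m ω).card : ℝ))) ∂(crp P) with hD
    have hDs : Measurable fun ω => (lateCount m n ω : ℝ≥0∞) +
        ENNReal.ofReal (P.β + P.α * ((tables m ω).card : ℝ)) :=
      (measurable_lateCount m n).add hw
    calc ∫⁻ ω, ((lateCount m (n + 1) ω : ℝ≥0∞) +
          ENNReal.ofReal (P.β + P.α * ((tables m ω).card : ℝ))) ∂(crp P)
        = ∫⁻ ω, (((lateCount m n ω : ℝ≥0∞) +
          ENNReal.ofReal (P.β + P.α * ((tables m ω).card : ℝ))) +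
            if ω (n + 1) ∉ A (history n ω) then 1 else 0) ∂(crp P) := by
          refine lintegral_congr fun ω => ?_
          rw [hstep, add_right_comm]
      _ = D + ENNReal.ofReal (1 / ((n : ℝ) + 1 + P.β)) * D := by
          rw [lintegral_add_left hDs, hnext]
          simp_rw [hcond]
          rw [lintegral_const_mul _ hDs]
      _ = ENNReal.ofReal (((n : ℝ) + 1 + P.β + 1) / ((n : ℝ) + 1 + P.β)) * D := by
          rw [add_div, div_self hn.ne', ENNReal.ofReal_add zero_le_one (by positivity),
            ENNReal.ofReal_one, add_mul, one_mul]
      _ ≤ ENNReal.ofReal (((n : ℝ) + 1 + P.β + 1) / ((n : ℝ) + 1 + P.β)) *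
          (ENNReal.ofReal (((n : ℝ) + 1 + P.β) / ((m : ℝ) + 1 + P.β)) *
            ∫⁻ ω, ENNReal.ofReal (P.β + P.α * ((tables m ω).card : ℝ)) ∂(crp P)) := by gcongr
      _ = _ := by
          rw [← mul_assoc, ← ENNReal.ofReal_mul (by positivity), div_mul_div_cancel₀ hn.ne']
          congr 3
          push_cast
          ring

/-- The total limiting weight of the tables that are opened after time `m`. -/
noncomputable def tailWeight (m : ℕ) (ω : ℕ → ℕ) : ℝ≥0∞ :=
  ∑' k, if k ∈ tables m ω then 0 else pyWeight ω k

theorem tailWeight_le_liminf (m : ℕ) (ω : ℕ → ℕ) :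
    tailWeight m ω ≤ liminf (fun n : ℕ => (lateCount m n ω : ℝ≥0∞) / (n + 1 : ℕ)) atTop := by
  have hshift : ∀ k, pyWeight ω k = liminf (fun n => tableFreq ω (n + 1) k) atTop := fun k =>
    (liminf_nat_add (fun n => tableFreq ω n k) 1).symm
  have hterm : ∀ k, (if k ∈ tables m ω then 0 else pyWeight ω k) =
      liminf (fun n => if k ∈ tables m ω then 0 else tableFreq ω (n + 1) k) atTop := by
    intro k
    by_cases hk : k ∈ tables m ω
    · simp [hk]
    · simp [hk, hshift]
  calc tailWeight m ω
      = ∫⁻ k, liminf (fun n => if k ∈ tables m ω then 0 else tableFreq ω (n + 1) k) atTop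
          ∂Measure.count := by
        rw [lintegral_count, tailWeight]
        exact tsum_congr hterm
    _ ≤ liminf (fun n => ∫⁻ k, (if k ∈ tables m ω then 0 else tableFreq ω (n + 1) k)
          ∂Measure.count) atTop := lintegral_liminf_le fun n => Measurable.of_discrete
    _ ≤ liminf (fun n : ℕ => (lateCount m n ω : ℝ≥0∞) / (n + 1 : ℕ)) atTop := by
        refine liminf_le_liminf (Eventually.of_forall fun n => ?_)
        rw [lintegral_count]
        calc ∑' k, (if k ∈ tables m ω then 0 else tableFreq ω (n + 1) k)
            = ∑' k, (∑ i ∈ Finset.range (n + 1),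
                if ω i = k then (if ω i ∉ tables m ω then (1 : ℝ≥0∞) else 0) else 0) /
                  (n + 1 : ℕ) := by
              refine tsum_congr fun k => ?_
              rw [tableFreq, Finset.card_filter]
              push_cast
              by_cases hk : k ∈ tables m ω
              · rw [if_pos hk, eq_comm, ENNReal.div_eq_zero_iff]
                left
                refine Finset.sum_eq_zero fun i _ => ?_
                by_cases hi : ω i = k
                · rw [if_pos hi, hi, if_neg (not_not.2 hk)]
                · rw [if_neg hi]
              · rw [if_neg hk]
                congr 1
                refine Finset.sum_congr rfl fun i _ => ?_
                by_cases hi : ω i = k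
                · rw [if_pos hi, if_pos hi, hi, if_pos hk]
                · rw [if_neg hi, if_neg hi]
          _ = (∑ i ∈ Finset.range (n + 1), if ω i ∉ tables m ω then (1 : ℝ≥0∞) else 0) /
                  (n + 1 : ℕ) := by
              simp_rw [div_eq_mul_inv]
              rw [ENNReal.tsum_mul_right, Summable.tsum_finsetSum fun i _ => ENNReal.summable]
              congr 1
              refine Finset.sum_congr rfl fun i _ => ?_
              rw [tsum_eq_single (ω i) fun k hk => if_neg (Ne.symm hk), if_pos rfl]
          _ ≤ _ := by rw [natCast_lateCount]

/-- The expected weight of the tables opened after time `m` is at most a constant times the expected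
number of tables at time `m`, divided by `m + 1`. -/
theorem lintegral_tailWeight_le (P : PYParam) (m : ℕ) :
    ∫⁻ ω, tailWeight m ω ∂(crp P) ≤
      ENNReal.ofReal ((1 + |P.β|) * (|P.β| + 1) / ((m : ℝ) + 1 + P.β)) *
        ∫⁻ ω, ((tables m ω).card : ℝ≥0∞) ∂(crp P) := by
  have hm := P.den_pos m
  set W := ∫⁻ ω, ENNReal.ofReal (P.β + P.α * ((tables m ω).card : ℝ)) ∂(crp P) with hW
  have hWle : W ≤ ENNReal.ofReal (|P.β| + 1) * ∫⁻ ω, ((tables m ω).card : ℝ≥0∞) ∂(crp P) := by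
    rw [← lintegral_const_mul _ (measurable_comp_history fun h => ((occupied h).card : ℝ≥0∞))]
    refine lintegral_mono fun ω => ?_
    rw [← ENNReal.ofReal_natCast, ← ENNReal.ofReal_mul (by positivity)]
    refine ENNReal.ofReal_le_ofReal ?_
    have hK := one_le_card_occupied (history m ω)
    have := mul_le_mul_of_nonneg_left hK (abs_nonneg P.β)
    nlinarith [le_abs_self P.β, P.α_lt_one]
  calc ∫⁻ ω, tailWeight m ω ∂(crp P)
      ≤ ∫⁻ ω, liminf (fun n : ℕ => (lateCount m n ω : ℝ≥0∞) / (n + 1 : ℕ)) atTop ∂(crp P) :=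
        lintegral_mono fun ω => tailWeight_le_liminf m ω
    _ ≤ liminf (fun n : ℕ => ∫⁻ ω, (lateCount m n ω : ℝ≥0∞) / (n + 1 : ℕ) ∂(crp P)) atTop :=
        lintegral_liminf_le fun n => (measurable_lateCount m n).div_const _
    _ ≤ ENNReal.ofReal ((1 + |P.β|) / ((m : ℝ) + 1 + P.β)) * W := by
        refine liminf_le_of_frequently_le' (Eventually.frequently ?_)
        filter_upwards [eventually_ge_atTop m] with n hn
        have hn1 : (0 : ℝ) < (n + 1 : ℕ) := by positivity
        simp_rw [div_eq_mul_inv]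
        rw [lintegral_mul_const _ (measurable_lateCount m n)]
        calc _ ≤ (ENNReal.ofReal (((n : ℝ) + 1 + P.β) / ((m : ℝ) + 1 + P.β)) * W) *
                ((n + 1 : ℕ) : ℝ≥0∞)⁻¹ := by
              gcongr
              exact (lintegral_mono fun ω => le_self_add).trans (lintegral_lateCount_add_le P hn)
          _ = ENNReal.ofReal (((n : ℝ) + 1 + P.β) / ((m : ℝ) + 1 + P.β) / (n + 1 : ℕ)) * W := by
              rw [ENNReal.ofReal_div_of_pos hn1, ENNReal.ofReal_natCast,
                div_eq_mul_inv (ENNReal.ofReal _) _, mul_right_comm]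
          _ ≤ _ := by
              gcongr
              rw [← div_eq_mul_inv, div_right_comm]
              gcongr
              rw [div_le_iff₀ hn1]
              push_cast
              nlinarith [le_abs_self P.β, abs_nonneg P.β, n.cast_nonneg (α := ℝ)]
    _ ≤ _ := by
        calc _ ≤ ENNReal.ofReal ((1 + |P.β|) / ((m : ℝ) + 1 + P.β)) *
              (ENNReal.ofReal (|P.β| + 1) * ∫⁻ ω, ((tables m ω).card : ℝ≥0∞) ∂(crp P)) := by gcongr
          _ = _ := by
              rw [← mul_assoc, ← ENNReal.ofReal_mul (by positivity), div_mul_eq_mul_div]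

/-- The number of tables after `m + 1` customers, plus the expected number of visits of
`m + 1` fresh samples to later tables, is of order `(m + 1) ^ α` up to a logarithm. -/
theorem exists_lintegral_card_add_tailWeight_le (P : PYParam) :
    ∃ C : ℝ, 0 < C ∧ ∀ m : ℕ,
      ∫⁻ ω, (((tables m ω).card : ℝ≥0∞) + ((m + 1 : ℕ) : ℝ≥0∞) * tailWeight m ω) ∂(crp P) ≤
      ENNReal.ofReal (C * (((m : ℝ) + 1) ^ P.α * (1 + Real.log ((m : ℝ) + 1)))) := by
  obtain ⟨C, hC, hK⟩ := exists_lintegral_card_tables_le P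
  have hβ : 0 < 1 + P.β := by simpa using P.den_pos 0
  set c : ℝ := (1 + |P.β|) * (|P.β| + 1) * (1 + 1 / (1 + P.β)) with hc
  have hc0 : 0 ≤ c := by positivity
  refine ⟨(1 + c) * C, by positivity, fun m => ?_⟩
  have hm := P.den_pos m
  have hm1 : (0 : ℝ) < (m : ℝ) + 1 := by positivity
  have hratio : ((m : ℝ) + 1) * ((1 + |P.β|) * (|P.β| + 1) / ((m : ℝ) + 1 + P.β)) ≤ c := by
    rw [mul_div_left_comm, hc]
    refine mul_le_mul_of_nonneg_left ?_ (by positivity)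
    rw [div_le_iff₀ hm]
    have h1 : 1 / (1 + P.β) * ((m : ℝ) + 1 + P.β) = 1 + m / (1 + P.β) := by
      field_simp
      ring
    have h2 : 0 ≤ (m : ℝ) / (1 + P.β) := by positivity
    rw [add_mul, one_mul, h1]
    linarith
  have hmeas : Measurable fun ω => ((tables m ω).card : ℝ≥0∞) :=
    measurable_comp_history fun h => ((occupied h).card : ℝ≥0∞)
  rw [lintegral_add_left hmeas, lintegral_const_mul' _ _ (ENNReal.natCast_ne_top _)]
  set I := ∫⁻ ω, ((tables m ω).card : ℝ≥0∞) ∂(crp P) with hI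
  calc I + ((m + 1 : ℕ) : ℝ≥0∞) * ∫⁻ ω, tailWeight m ω ∂(crp P)
      ≤ I + ENNReal.ofReal ((m : ℝ) + 1) *
          (ENNReal.ofReal ((1 + |P.β|) * (|P.β| + 1) / ((m : ℝ) + 1 + P.β)) * I) := by
        rw [← ENNReal.ofReal_natCast, Nat.cast_succ]
        gcongr
        exact lintegral_tailWeight_le P m
    _ ≤ I + ENNReal.ofReal c * I := by
        rw [← mul_assoc, ← ENNReal.ofReal_mul hm1.le]
        gcongr
    _ = ENNReal.ofReal (1 + c) * I := by
        rw [ENNReal.ofReal_add zero_le_one hc0, ENNReal.ofReal_one, add_mul, one_mul]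
    _ ≤ _ := by
        rw [mul_assoc, ENNReal.ofReal_mul (by positivity)]
        gcongr
        exact hK m

end Restaurant

/-! ### Rounding of parameters and weights -/

section Quantization

/-- A grid of at most `(2 + N + L) ^ d` points of the unit ball approximates every point well enough
for `N` samples: cells of side `2 / m` with `m ≥ N + L ≥ 2 √(N L)` suffice. -/
theorem exists_grid (d N : ℕ) (hN : 1 ≤ N) {L : ℝ} (hL : 0 < L) :
    ∃ m : ℕ, 1 ≤ m ∧ (m : ℝ) ≤ 2 + N + L ∧ ∃ g : (Fin d → Fin m) → ParamBall d,
      ∀ φ : ParamBall d, ∃ j, (N : ℝ) * (L * ‖(φ : EuclideanSpace ℝ (Fin d)) -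
        (g j : EuclideanSpace ℝ (Fin d))‖ ^ 2) ≤ d := by
  have hN' : (1 : ℝ) ≤ N := by exact_mod_cast hN
  set k : ℕ := ⌈(N : ℝ) + L⌉₊ with hk
  have hkN : (N : ℝ) + L ≤ k := Nat.le_ceil _
  have hk0 : (0 : ℝ) < k := by linarith
  refine ⟨k + 1, by omega, ?_, ?_⟩
  · have := Nat.ceil_lt_add_one (show (0 : ℝ) ≤ N + L by positivity)
    push_cast
    linarith
  -- the cell of a point is determined by the integer parts of its rescaled coordinates
  have hcoord : ∀ (φ : ParamBall d) (i : Fin d),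
      |(φ : EuclideanSpace ℝ (Fin d)) i| ≤ 1 := fun φ i => by
    have h1 : ‖(φ : EuclideanSpace ℝ (Fin d))‖ ≤ 1 :=
      mem_closedBall_zero_iff.1 φ.2
    exact (PiLp.norm_apply_le (φ : EuclideanSpace ℝ (Fin d)) i).trans h1
  let t : ParamBall d → Fin d → ℝ := fun φ i => ((φ : EuclideanSpace ℝ (Fin d)) i + 1) * (k / 2)
  have ht0 : ∀ φ i, 0 ≤ t φ i := fun φ i => by
    have := (abs_le.1 (hcoord φ i)).1
    exact mul_nonneg (by linarith) (by positivity)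
  have htk : ∀ φ i, ⌊t φ i⌋₊ < k + 1 := fun φ i => by
    have := (abs_le.1 (hcoord φ i)).2
    rw [Nat.lt_succ_iff]
    refine Nat.floor_le_of_le ?_
    have : ((φ : EuclideanSpace ℝ (Fin d)) i + 1) * (k / 2) ≤ 2 * (k / 2) := by gcongr; linarith
    simpa [t] using this.trans_eq (by ring)
  let cell : ParamBall d → Fin d → Fin (k + 1) := fun φ i => ⟨⌊t φ i⌋₊, htk φ i⟩
  have : Nonempty (ParamBall d) := ⟨⟨0, by simp⟩⟩
  refine ⟨Function.invFun cell, fun φ => ⟨cell φ, ?_⟩⟩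
  set ψ := Function.invFun cell (cell φ) with hψ
  have hcell : cell ψ = cell φ := Function.invFun_eq ⟨φ, rfl⟩
  have hdiff : ∀ i, ((φ : EuclideanSpace ℝ (Fin d)) i - (ψ : EuclideanSpace ℝ (Fin d)) i) ^ 2 ≤
      (2 / k) ^ 2 := by
    intro i
    have hfl : ⌊t ψ i⌋₊ = ⌊t φ i⌋₊ := congrArg Fin.val (congrFun hcell i)
    have h1 := Nat.floor_le (ht0 φ i)
    have h2 := Nat.lt_floor_add_one (t φ i)
    have h3 := Nat.floor_le (ht0 ψ i)
    have h4 := Nat.lt_floor_add_one (t ψ i)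
    rw [hfl] at h3 h4
    have h5 : |t φ i - t ψ i| ≤ 1 := abs_le.2 ⟨by linarith, by linarith⟩
    have h6 : t φ i - t ψ i = ((φ : EuclideanSpace ℝ (Fin d)) i -
        (ψ : EuclideanSpace ℝ (Fin d)) i) * (k / 2) := by simp only [t]; ring
    rw [h6, abs_mul, abs_of_pos (show (0 : ℝ) < k / 2 by positivity)] at h5
    rw [← sq_abs]
    have : |(φ : EuclideanSpace ℝ (Fin d)) i - (ψ : EuclideanSpace ℝ (Fin d)) i| ≤ 2 / k := by
      rw [le_div_iff₀ hk0]
      linarith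
    gcongr
  have hnorm : ‖(φ : EuclideanSpace ℝ (Fin d)) - (ψ : EuclideanSpace ℝ (Fin d))‖ ^ 2 ≤
      d * (2 / k) ^ 2 := by
    rw [EuclideanSpace.norm_sq_eq]
    calc ∑ i, ‖((φ : EuclideanSpace ℝ (Fin d)) - (ψ : EuclideanSpace ℝ (Fin d))) i‖ ^ 2
        ≤ ∑ _i : Fin d, ((2 : ℝ) / k) ^ 2 := by
          refine Finset.sum_le_sum fun i _ => ?_
          rw [Real.norm_eq_abs, sq_abs, PiLp.sub_apply]
          exact hdiff i
      _ = _ := by simp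
  have hkey : (N : ℝ) * (L * (2 / k) ^ 2) ≤ 1 := by
    rw [div_pow, mul_div_assoc', mul_div_assoc', div_le_one (by positivity)]
    nlinarith [sq_nonneg ((N : ℝ) - L)]
  calc (N : ℝ) * (L * ‖(φ : EuclideanSpace ℝ (Fin d)) - (ψ : EuclideanSpace ℝ (Fin d))‖ ^ 2)
      ≤ N * (L * (d * (2 / k) ^ 2)) := by gcongr
    _ = d * (N * (L * (2 / k) ^ 2)) := by ring
    _ ≤ d * 1 := by gcongr
    _ = d := mul_one _

/-- The probability vector with weights proportional to `j i + 1`. -/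
noncomputable def roundedWeights {ι : Type*} [Fintype ι] [MeasurableSpace ι] {N : ℕ}
    (j : ι → Fin (N + 1)) : Measure ι :=
  ∑ i, ENNReal.ofReal ((((j i : ℕ) : ℝ) + 1) / ∑ i', (((j i' : ℕ) : ℝ) + 1)) • Measure.dirac i

instance {ι : Type*} [Fintype ι] [Nonempty ι] [MeasurableSpace ι] {N : ℕ}
    (j : ι → Fin (N + 1)) : IsProbabilityMeasure (roundedWeights j) := ⟨by
  have hpos : 0 < ∑ i', (((j i' : ℕ) : ℝ) + 1) :=
    Finset.sum_pos (fun i _ => by positivity) Finset.univ_nonempty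
  simp only [roundedWeights, Measure.coe_finsetSum, Finset.sum_apply, Measure.smul_apply,
    measure_univ, smul_eq_mul, mul_one]
  rw [← ENNReal.ofReal_sum_of_nonneg (fun i _ => by positivity), ← Finset.sum_div,
    div_self hpos.ne', ENNReal.ofReal_one]⟩

theorem roundedWeights_singleton {ι : Type*} [Fintype ι] [MeasurableSpace ι]
    [MeasurableSingletonClass ι] {N : ℕ} (j : ι → Fin (N + 1)) (i : ι) :
    roundedWeights j {i} =
      ENNReal.ofReal ((((j i : ℕ) : ℝ) + 1) / ∑ i', (((j i' : ℕ) : ℝ) + 1)) := by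
  classical
  simp only [roundedWeights, Measure.coe_finsetSum, Finset.sum_apply, Measure.smul_apply,
    smul_eq_mul]
  rw [Finset.sum_eq_single i]
  · simp
  · intro b _ hb
    simp [hb]
  · simp

/-- Rounding the weights of a probability vector to multiples of `1 / N` costs at most `|ι|` over
`N` samples. -/
theorem exists_roundedWeights {ι : Type*} [Fintype ι] [Nonempty ι] [MeasurableSpace ι]
    [MeasurableSingletonClass ι] {N : ℕ} (hN : 1 ≤ N) (q : Measure ι) [IsProbabilityMeasure q] :
    ∃ j : ι → Fin (N + 1), (N : ℝ≥0∞) * klDiv q (roundedWeights j) ≤ (Fintype.card ι : ℝ≥0∞) := by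
  have hN' : (0 : ℝ) < N := by exact_mod_cast hN
  have hq1 : ∀ i, q.real {i} ≤ 1 := fun i => measureReal_le_one
  have hfl : ∀ i, ⌊(N : ℝ) * q.real {i}⌋₊ < N + 1 := fun i => by
    rw [Nat.lt_succ_iff]
    exact Nat.floor_le_of_le (mul_le_of_le_one_right hN'.le (hq1 i))
  let j : ι → Fin (N + 1) := fun i => ⟨⌊(N : ℝ) * q.real {i}⌋₊, hfl i⟩
  set T : ℝ := ∑ i', (((j i' : ℕ) : ℝ) + 1) with hT
  have hTpos : 0 < T := Finset.sum_pos (fun i _ => by positivity) Finset.univ_nonempty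
  have hTle : T ≤ N + Fintype.card ι := by
    have hsum : ∑ i, q.real {i} = 1 := by
      rw [sum_measureReal_singleton, Finset.coe_univ, probReal_univ]
    calc T ≤ ∑ i, ((N : ℝ) * q.real {i} + 1) := by
          refine Finset.sum_le_sum fun i _ => ?_
          have : ((j i : ℕ) : ℝ) ≤ N * q.real {i} :=
            Nat.floor_le (mul_nonneg hN'.le measureReal_nonneg)
          linarith
      _ = N + Fintype.card ι := by
          rw [Finset.sum_add_distrib, ← Finset.mul_sum, hsum]
          simp
  refine ⟨j, ?_⟩
  have hkl : klDiv q (roundedWeights j) ≤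
      ENNReal.ofReal (Real.log (1 + Fintype.card ι / N)) := by
    refine klDiv_le_log_of_forall_singleton q _ fun i => ?_
    rw [roundedWeights_singleton, ← ENNReal.ofReal_mul (by positivity), ← ofReal_measureReal]
    refine ENNReal.ofReal_le_ofReal ?_
    have h1 : N * q.real {i} ≤ ((j i : ℕ) : ℝ) + 1 := (Nat.lt_floor_add_one _).le
    rw [← hT, mul_div_assoc', le_div_iff₀ hTpos]
    calc q.real {i} * T ≤ q.real {i} * (N + Fintype.card ι) := by gcongr
      _ = (1 + Fintype.card ι / N) * (N * q.real {i}) := by field_simp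
      _ ≤ _ := by gcongr
  calc (N : ℝ≥0∞) * klDiv q (roundedWeights j)
      ≤ ENNReal.ofReal N * ENNReal.ofReal (Real.log (1 + Fintype.card ι / N)) := by
        rw [ENNReal.ofReal_natCast]
        gcongr
    _ = ENNReal.ofReal (N * Real.log (1 + Fintype.card ι / N)) :=
        (ENNReal.ofReal_mul hN'.le).symm
    _ ≤ ENNReal.ofReal (Fintype.card ι) := by
        refine ENNReal.ofReal_le_ofReal ?_
        have : Real.log (1 + Fintype.card ι / N) ≤ Fintype.card ι / N := by
          have := Real.log_le_sub_one_of_pos (show (0 : ℝ) < 1 + Fintype.card ι / N by positivity)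
          linarith
        calc (N : ℝ) * Real.log (1 + Fintype.card ι / N) ≤ N * (Fintype.card ι / N) := by gcongr
          _ = Fintype.card ι := by field_simp
    _ = _ := ENNReal.ofReal_natCast _

end Quantization

/-! ### Codewords for the knowledge model -/

section KnowledgeCode

variable {d n N m : ℕ} {𝕂 : Type u} [Fintype 𝕂] [Nonempty 𝕂] [MeasurableSpace 𝕂]
  [MeasurableSingletonClass 𝕂]

/-- The law of the knowledge element given its cluster: cluster `0` stands for all clusters that are
not modelled and draws from `tail`, cluster `i + 1` draws from `P_{ψ i}`. -/
noncomputable def clusterKernel (knw : Kernel (ParamBall d) 𝕂) (tail : Measure 𝕂)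
    (ψ : Fin n → ParamBall d) : Kernel (Fin (n + 1)) 𝕂 :=
  Kernel.ofFunOfCountable (Fin.cons (α := fun _ => Measure 𝕂) tail fun i => knw (ψ i))

instance (knw : Kernel (ParamBall d) 𝕂) [IsMarkovKernel knw] (tail : Measure 𝕂)
    [IsProbabilityMeasure tail] (ψ : Fin n → ParamBall d) :
    IsMarkovKernel (clusterKernel knw tail ψ) := ⟨fun i => by
  refine Fin.cases ?_ (fun i => ?_) i
  · exact inferInstanceAs (IsProbabilityMeasure tail)
  · exact inferInstanceAs (IsProbabilityMeasure (knw (ψ i)))⟩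

/-- The codeword of the knowledge model with rounded cluster weights `j.1` and grid points `j.2` as
cluster parameters. Knowledge elements from clusters that are not modelled are uniform. -/
noncomputable def knowledgeCode (knw : Kernel (ParamBall d) 𝕂)
    (g : (Fin d → Fin m) → ParamBall d)
    (j : (Fin (n + 1) → Fin (N + 1)) × (Fin n → Fin d → Fin m)) : Measure 𝕂 :=
  clusterKernel knw (uniformMixture Measure.dirac) (fun i => g (j.2 i)) ∘ₘ roundedWeights j.1

instance (knw : Kernel (ParamBall d) 𝕂) [IsMarkovKernel knw] (g : (Fin d → Fin m) → ParamBall d)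
    (j : (Fin (n + 1) → Fin (N + 1)) × (Fin n → Fin d → Fin m)) :
    IsProbabilityMeasure (knowledgeCode knw g j) :=
  inferInstanceAs (IsProbabilityMeasure (clusterKernel knw _ _ ∘ₘ roundedWeights j.1))

/-- A mixing distribution with `n` atoms and a remainder `ρ` is approximated by a codeword: over `N`
samples the rounding of the weights costs `n + 1`, that of the atoms `d`, and each sample from the
remainder costs `log |𝕂|`. -/
theorem exists_knowledgeCode (hN : 1 ≤ N) (knw : Kernel (ParamBall d) 𝕂) [IsMarkovKernel knw]
    {L : ℝ} (hL : LipschitzKL knw L) (g : (Fin d → Fin m) → ParamBall d)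
    (hg : ∀ φ : ParamBall d, ∃ j, (N : ℝ) * (L * ‖(φ : EuclideanSpace ℝ (Fin d)) -
        (g j : EuclideanSpace ℝ (Fin d))‖ ^ 2) ≤ d)
    (μ : Measure (ParamBall d)) [IsProbabilityMeasure μ] (q : Fin n → ℝ≥0∞)
    (φ : Fin n → ParamBall d) (ρ : Measure (ParamBall d))
    (hμ : μ = (∑ i, q i • Measure.dirac (φ i)) + ρ) :
    ∃ j : (Fin (n + 1) → Fin (N + 1)) × (Fin n → Fin d → Fin m),
      (N : ℝ≥0∞) * klDiv (knw ∘ₘ μ) (knowledgeCode knw g j) ≤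
        (n + 1 : ℕ) + d + N * ρ Set.univ * ENNReal.ofReal (Real.log (Fintype.card 𝕂)) := by
  classical
  have htot : (∑ i, q i) + ρ Set.univ = 1 := by
    have h1 : μ Set.univ = 1 := measure_univ
    rw [hμ] at h1
    simpa using h1
  have hq1 : ∑ i, q i ≤ 1 := htot ▸ le_self_add
  have hρ1 : ρ Set.univ ≤ 1 := htot ▸ le_add_self
  have hρfin : IsFiniteMeasure ρ := ⟨hρ1.trans_lt ENNReal.one_lt_top⟩
  -- the law of the knowledge element, given that its cluster is not modelled
  obtain ⟨tail, htail, htailρ⟩ : ∃ tail : Measure 𝕂, IsProbabilityMeasure tail ∧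
      ρ Set.univ • tail = knw ∘ₘ ρ := by
    by_cases h0 : ρ Set.univ = 0
    · refine ⟨uniformMixture Measure.dirac, inferInstance, ?_⟩
      rw [h0, zero_smul, Measure.measure_univ_eq_zero.1 h0, Measure.bind_zero_left]
    · refine ⟨(ρ Set.univ)⁻¹ • (knw ∘ₘ ρ), ⟨?_⟩, ?_⟩
      · rw [Measure.smul_apply, Measure.bind_apply MeasurableSet.univ knw.aemeasurable]
        simp [ENNReal.inv_mul_cancel h0 (measure_ne_top _ _)]
      · rw [smul_smul, ENNReal.mul_inv_cancel h0 (measure_ne_top _ _), one_smul]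
  set Q : Measure (Fin (n + 1)) :=
    ρ Set.univ • Measure.dirac 0 + ∑ i, q i • Measure.dirac i.succ with hQ
  have hQprob : IsProbabilityMeasure Q := ⟨by
    rw [hQ]
    simpa [add_comm] using htot⟩
  have hcomp : knw ∘ₘ μ = clusterKernel knw tail φ ∘ₘ Q := by
    ext s hs
    rw [Measure.bind_apply hs (Kernel.aemeasurable _), Measure.bind_apply hs (Kernel.aemeasurable _),
      hμ, hQ, lintegral_add_measure, lintegral_add_measure, lintegral_finsetSum_measure,
      lintegral_finsetSum_measure, add_comm]
    congr 1
    · rw [← Measure.bind_apply hs (Kernel.aemeasurable _), ← htailρ, lintegral_smul_measure,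
        lintegral_dirac]
      rfl
    · refine Finset.sum_congr rfl fun i _ => ?_
      rw [lintegral_smul_measure, lintegral_smul_measure, lintegral_dirac' _
        (Kernel.measurable_coe knw hs), lintegral_dirac]
      rfl
  obtain ⟨jw, hjw⟩ := exists_roundedWeights hN Q
  choose jg hjg using fun i => hg (φ i)
  refine ⟨(jw, jg), ?_⟩
  set κ' := clusterKernel knw (uniformMixture Measure.dirac) (fun i => g (jg i)) with hκ'
  have hint : ∫⁻ a, klDiv (clusterKernel knw tail φ a) (κ' a) ∂Q =
      ρ Set.univ * klDiv tail (uniformMixture Measure.dirac) +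
        ∑ i, q i * klDiv (knw (φ i)) (knw (g (jg i))) := by
    rw [hQ, lintegral_add_measure, lintegral_finsetSum_measure, lintegral_smul_measure,
      lintegral_dirac]
    congr 1
    refine Finset.sum_congr rfl fun i _ => ?_
    rw [lintegral_smul_measure, lintegral_dirac]
    rfl
  have hatom : ∀ i, (N : ℝ≥0∞) * klDiv (knw (φ i)) (knw (g (jg i))) ≤ d := by
    intro i
    calc (N : ℝ≥0∞) * klDiv (knw (φ i)) (knw (g (jg i)))
        ≤ ENNReal.ofReal N * ENNReal.ofReal (L * ‖(φ i : EuclideanSpace ℝ (Fin d)) -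
            (g (jg i) : EuclideanSpace ℝ (Fin d))‖ ^ 2) := by
          rw [ENNReal.ofReal_natCast]
          gcongr
          exact hL _ _
      _ ≤ ENNReal.ofReal d := by
          rw [← ENNReal.ofReal_mul (Nat.cast_nonneg _)]
          exact ENNReal.ofReal_le_ofReal (hjg i)
      _ = d := ENNReal.ofReal_natCast d
  calc (N : ℝ≥0∞) * klDiv (knw ∘ₘ μ) (knowledgeCode knw g (jw, jg))
      ≤ N * (klDiv Q (roundedWeights jw) +
          ∫⁻ a, klDiv (clusterKernel knw tail φ a) (κ' a) ∂Q) := by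
        rw [hcomp]
        gcongr
        exact klDiv_comp_le _ _ _ _
    _ = N * klDiv Q (roundedWeights jw) +
          N * ρ Set.univ * klDiv tail (uniformMixture Measure.dirac) +
          ∑ i, q i * (N * klDiv (knw (φ i)) (knw (g (jg i)))) := by
        rw [hint, mul_add, mul_add, Finset.mul_sum, ← add_assoc, mul_assoc]
        congr 1
        exact Finset.sum_congr rfl fun i _ => mul_left_comm _ _ _
    _ ≤ (n + 1 : ℕ) + N * ρ Set.univ * ENNReal.ofReal (Real.log (Fintype.card 𝕂)) +
          ∑ i, q i * (d : ℝ≥0∞) := by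
        gcongr with i
        · simpa using hjw
        · exact klDiv_uniformMixture_dirac_le _
        · exact hatom i
    _ ≤ (n + 1 : ℕ) + N * ρ Set.univ * ENNReal.ofReal (Real.log (Fintype.card 𝕂)) + d := by
        rw [← Finset.sum_mul]
        gcongr
        exact mul_le_of_le_one_left zero_le hq1
    _ = _ := add_right_comm _ _ _

end KnowledgeCode

/-! ### Laws of sentences -/

section SentenceCode

variable {dknw dsyn ns : ℕ} {𝕂 : Type u} {Ξ : Type v} {S : Type w}
  [Fintype 𝕂] [MeasurableSpace 𝕂] [MeasurableSingletonClass 𝕂]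
  [MeasurableSpace Ξ] [MeasurableSpace S]

/-- The law of a sentence whose knowledge element has law `Q` and whose syntax parameters
are `s`. -/
noncomputable def sentenceLaw (syn : Kernel (ParamBall dsyn) Ξ) (sel : 𝕂 → Fin ns)
    (enc : 𝕂 × Ξ → S) (Q : Measure 𝕂) (s : Fin ns → ParamBall dsyn) : Measure S :=
  (Q ⊗ₘ Kernel.ofFunOfCountable fun k => syn (s (sel k))).map enc

instance (syn : Kernel (ParamBall dsyn) Ξ) [IsMarkovKernel syn] (sel : 𝕂 → Fin ns)
    (s : Fin ns → ParamBall dsyn) :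
    IsMarkovKernel (Kernel.ofFunOfCountable fun k => syn (s (sel k))) :=
  ⟨fun k => inferInstanceAs (IsProbabilityMeasure (syn (s (sel k))))⟩

theorem isProbabilityMeasure_sentenceLaw (syn : Kernel (ParamBall dsyn) Ξ) [IsMarkovKernel syn]
    (sel : 𝕂 → Fin ns) {enc : 𝕂 × Ξ → S} (henc : Measurable enc) (Q : Measure 𝕂)
    [IsProbabilityMeasure Q] (s : Fin ns → ParamBall dsyn) :
    IsProbabilityMeasure (sentenceLaw syn sel enc Q s) :=
  Measure.isProbabilityMeasure_map henc.aemeasurable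

theorem sentenceKernel_eq_sentenceLaw (knw : Kernel (ParamBall dknw) 𝕂) [IsMarkovKernel knw]
    (syn : Kernel (ParamBall dsyn) Ξ) [IsMarkovKernel syn] (sel : 𝕂 → Fin ns)
    (enc : 𝕂 × Ξ → S) (henc : Measurable enc) (θ : DataParam dknw dsyn ns) :
    sentenceKernel knw syn sel enc henc θ =
      sentenceLaw syn sel enc (knw ∘ₘ (θ.1 : Measure (ParamBall dknw))) θ.2 := by
  rw [sentenceKernel, Kernel.map_apply _ henc, Kernel.compProd_apply_eq_compProd_sectR,
    sentenceLaw]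
  congr 2

/-- The chain rule over (knowledge element, syntactic element) and data processing through `enc`:
over `N` sentences, rounding the syntax parameters to the grid costs at most `dsyn`. -/
theorem mul_klDiv_sentenceLaw_le {N : ℕ} (syn : Kernel (ParamBall dsyn) Ξ) [IsMarkovKernel syn]
    {L : ℝ} (hL : LipschitzKL syn L) (sel : 𝕂 → Fin ns) {enc : 𝕂 × Ξ → S}
    (henc : Measurable enc) (Q Q' : Measure 𝕂) [IsProbabilityMeasure Q] [IsProbabilityMeasure Q']
    (s s' : Fin ns → ParamBall dsyn)
    (hs : ∀ i, (N : ℝ) * (L * ‖(s i : EuclideanSpace ℝ (Fin dsyn)) -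
      (s' i : EuclideanSpace ℝ (Fin dsyn))‖ ^ 2) ≤ dsyn) :
    (N : ℝ≥0∞) * klDiv (sentenceLaw syn sel enc Q s) (sentenceLaw syn sel enc Q' s') ≤
      N * klDiv Q Q' + dsyn := by
  calc (N : ℝ≥0∞) * klDiv (sentenceLaw syn sel enc Q s) (sentenceLaw syn sel enc Q' s')
      ≤ N * (klDiv Q Q' + ∫⁻ k, klDiv (syn (s (sel k))) (syn (s' (sel k))) ∂Q) := by
        gcongr
        refine (klDiv_map_le _ _ henc).trans ?_
        rw [klDiv_compProd_eq_add, klDiv_compProd_right_eq_lintegral]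
        rfl
    _ ≤ N * klDiv Q Q' + ∫⁻ _k, dsyn ∂Q := by
        rw [mul_add, ← lintegral_const_mul _ (Measurable.of_discrete)]
        gcongr with k
        calc (N : ℝ≥0∞) * klDiv (syn (s (sel k))) (syn (s' (sel k)))
            ≤ ENNReal.ofReal N * ENNReal.ofReal (L * ‖(s (sel k) : EuclideanSpace ℝ (Fin dsyn)) -
                (s' (sel k) : EuclideanSpace ℝ (Fin dsyn))‖ ^ 2) := by
              rw [ENNReal.ofReal_natCast]
              gcongr
              exact hL _ _
          _ ≤ ENNReal.ofReal dsyn := by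
              rw [← ENNReal.ofReal_mul (Nat.cast_nonneg _)]
              exact ENNReal.ofReal_le_ofReal (hs _)
          _ = dsyn := ENNReal.ofReal_natCast _
    _ = _ := by simp

end SentenceCode

/-! ### A universal model of the sentences -/

section Universal

variable {dknw dsyn ns : ℕ} {𝕂 : Type u} {Ξ : Type v} {S : Type w}
  [Fintype 𝕂] [MeasurableSpace 𝕂] [MeasurableSingletonClass 𝕂]
  [MeasurableSpace Ξ] [MeasurableSpace S]

theorem one_le_log {x : ℝ} (hx : 3 ≤ x) : 1 ≤ Real.log x := by
  rw [Real.le_log_iff_exp_le (by linarith)]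
  linarith [Real.exp_one_lt_d9]

/-- From finitely many laws of the knowledge element, a mixture over these laws and over the grid
of syntax parameters is a model of `N` sentences that pays the index of the law and
`2 ns dsyn log (2 + N + Lsyn + dsyn)` for the syntax. -/
theorem exists_model_of_family {J : Type*} [Fintype J] (N : ℕ) (hN : 1 ≤ N) (hns : 1 ≤ ns)
    (Q : J → Measure 𝕂) [∀ j, IsProbabilityMeasure (Q j)] [Nonempty J]
    (knw : Kernel (ParamBall dknw) 𝕂) [IsMarkovKernel knw]
    (syn : Kernel (ParamBall dsyn) Ξ) [IsMarkovKernel syn] (sel : 𝕂 → Fin ns)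
    (enc : 𝕂 × Ξ → S) (henc : Measurable enc) {L : ℝ} (hL0 : 0 < L) (hL : LipschitzKL syn L) :
    ∃ M : Measure (Fin N → S), IsProbabilityMeasure M ∧
      ∀ (θ : DataParam dknw dsyn ns) (j : J),
        klDiv (iidKernel (sentenceKernel knw syn sel enc henc) N θ) M ≤
          N * klDiv (knw ∘ₘ (θ.1 : Measure (ParamBall dknw))) (Q j) +
            ENNReal.ofReal (Real.log (Fintype.card J)) +
            ENNReal.ofReal (2 * (ns * dsyn * Real.log (2 + N + L + dsyn))) := by
  obtain ⟨m, hm1, hmle, g, hg⟩ := exists_grid dsyn N hN hL0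
  have : Nonempty (Fin m) := ⟨⟨0, hm1⟩⟩
  have hprob : ∀ (j : J) (a : Fin ns → Fin dsyn → Fin m),
      IsProbabilityMeasure (sentenceLaw syn sel enc (Q j) fun i => g (a i)) := fun j a =>
    isProbabilityMeasure_sentenceLaw syn sel henc _ _
  let ν : J × (Fin ns → Fin dsyn → Fin m) → Measure (Fin N → S) := fun p =>
    Measure.pi fun _ => sentenceLaw syn sel enc (Q p.1) fun i => g (p.2 i)
  have hν : ∀ p, IsProbabilityMeasure (ν p) := fun p =>
    inferInstanceAs (IsProbabilityMeasure
      (Measure.pi fun _ : Fin N => sentenceLaw syn sel enc (Q p.1) fun i => g (p.2 i)))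
  refine ⟨uniformMixture ν, inferInstance, fun θ j => ?_⟩
  choose a ha using fun i => hg (θ.2 i)
  have hN' : (1 : ℝ) ≤ N := by exact_mod_cast hN
  have hns' : (1 : ℝ) ≤ ns := by exact_mod_cast hns
  have hd0 : (0 : ℝ) ≤ dsyn := Nat.cast_nonneg _
  have hlog : Real.log (Fintype.card (J × (Fin ns → Fin dsyn → Fin m))) =
      Real.log (Fintype.card J) + ns * dsyn * Real.log m := by
    have hJ : (Fintype.card J : ℝ) ≠ 0 := by simp
    have hm0 : (m : ℝ) ≠ 0 := by positivity
    simp only [Fintype.card_prod, Fintype.card_pi, Fintype.card_fin, Finset.prod_const,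
      Finset.card_univ]
    push_cast
    rw [Real.log_mul hJ (by positivity), Real.log_pow, Real.log_pow]
    ring
  have hsyn : (dsyn : ℝ) + ns * dsyn * Real.log m ≤
      2 * (ns * dsyn * Real.log (2 + N + L + dsyn)) := by
    have h1 : Real.log m ≤ Real.log (2 + N + L + dsyn) :=
      Real.log_le_log (by exact_mod_cast hm1) (by linarith)
    have h2 : 1 ≤ Real.log (2 + N + L + dsyn) := one_le_log (by linarith)
    have h3 : (dsyn : ℝ) ≤ ns * dsyn * Real.log (2 + N + L + dsyn) := by
      calc (dsyn : ℝ) = 1 * dsyn * 1 := by ring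
        _ ≤ _ := by gcongr
    have h4 : ns * dsyn * Real.log m ≤ ns * dsyn * Real.log (2 + N + L + dsyn) := by gcongr
    linarith
  calc klDiv (iidKernel (sentenceKernel knw syn sel enc henc) N θ) (uniformMixture ν)
      ≤ klDiv (iidKernel (sentenceKernel knw syn sel enc henc) N θ) (ν (j, a)) +
          ENNReal.ofReal (Real.log (Fintype.card (J × (Fin ns → Fin dsyn → Fin m)))) :=
        klDiv_uniformMixture_le _ ν (j, a)
    _ ≤ (N * klDiv (knw ∘ₘ (θ.1 : Measure (ParamBall dknw))) (Q j) + dsyn) +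
          ENNReal.ofReal (Real.log (Fintype.card (J × (Fin ns → Fin dsyn → Fin m)))) := by
        gcongr
        refine (klDiv_pi_le _ _ N).trans ?_
        rw [sentenceKernel_eq_sentenceLaw]
        exact mul_klDiv_sentenceLaw_le syn hL sel henc _ _ _ _ ha
    _ = N * klDiv (knw ∘ₘ (θ.1 : Measure (ParamBall dknw))) (Q j) +
          ENNReal.ofReal (Real.log (Fintype.card J)) +
            ENNReal.ofReal ((dsyn : ℝ) + ns * dsyn * Real.log m) := by
        have h0 : 0 ≤ ns * dsyn * Real.log m :=
          mul_nonneg (by positivity) (Real.log_natCast_nonneg m)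
        rw [hlog, ENNReal.ofReal_add (Real.log_natCast_nonneg _) h0, ENNReal.ofReal_add hd0 h0,
          ENNReal.ofReal_natCast]
        ring
    _ ≤ _ := by gcongr

/-- One model of `N` sentences pays, for every mixing distribution with `n ≤ N` atoms and a
remainder `ρ`, a redundancy proportional to `n + N ρ(univ)`. -/
theorem exists_model (N : ℕ) (hN : 1 ≤ N) (hns : 1 ≤ ns) [Nonempty 𝕂]
    (knw : Kernel (ParamBall dknw) 𝕂) [IsMarkovKernel knw]
    (syn : Kernel (ParamBall dsyn) Ξ) [IsMarkovKernel syn] (sel : 𝕂 → Fin ns)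
    (enc : 𝕂 × Ξ → S) (henc : Measurable enc) {Lknw Lsyn : ℝ} (hLk0 : 0 < Lknw)
    (hLs0 : 0 < Lsyn) (hLk : LipschitzKL knw Lknw) (hLs : LipschitzKL syn Lsyn) :
    ∃ M : Measure (Fin N → S), IsProbabilityMeasure M ∧
      ∀ (θ : DataParam dknw dsyn ns) (n : ℕ) (_ : 1 ≤ n) (_ : n ≤ N) (q : Fin n → ℝ≥0∞)
        (φ : Fin n → ParamBall dknw) (ρ : Measure (ParamBall dknw))
        (_ : (θ.1 : Measure (ParamBall dknw)) = (∑ i, q i • Measure.dirac (φ i)) + ρ),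
        klDiv (iidKernel (sentenceKernel knw syn sel enc henc) N θ) M ≤
          ENNReal.ofReal (7 * (dknw * Real.log (2 + N + Lknw + dknw + Fintype.card 𝕂))) *
            ((n : ℝ≥0∞) + (N : ℝ≥0∞) * ρ Set.univ) +
            ENNReal.ofReal (2 * (ns * dsyn * Real.log (2 + N + Lsyn + dsyn))) := by
  rcases Nat.eq_zero_or_pos dknw with rfl | hd
  · -- the parameter space of the knowledge model is a single point
    obtain ⟨M, hM, h⟩ := exists_model_of_family N hN hns (fun _ : Unit => knw ⟨0, by simp⟩)
      knw syn sel enc henc hLs0 hLs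
    refine ⟨M, hM, fun θ n _ _ q φ ρ _ => (h θ ()).trans ?_⟩
    have hconst : knw = Kernel.const (ParamBall 0) (knw ⟨0, by simp⟩) := by
      ext1 x
      rw [Kernel.const_apply]
      congr 1
      exact Subsingleton.elim _ _
    have hcomp : knw ∘ₘ (θ.1 : Measure (ParamBall 0)) = knw ⟨0, by simp⟩ := by
      conv_lhs => rw [hconst]
      simp
    rw [hcomp, klDiv_self]
    simp
  · obtain ⟨m, hm1, hmle, g, hg⟩ := exists_grid dknw N hN hLk0
    have : Nonempty (Fin m) := ⟨⟨0, hm1⟩⟩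
    choose M hM h using fun n : ℕ => exists_model_of_family N hN hns
      (fun j : (Fin (n + 1) → Fin (N + 1)) × (Fin n → Fin dknw → Fin m) => knowledgeCode knw g j)
      knw syn sel enc henc hLs0 hLs
    have : Nonempty (Fin N) := ⟨⟨0, hN⟩⟩
    refine ⟨uniformMixture fun k : Fin N => M (k + 1), inferInstance,
      fun θ n hn1 hnN q φ ρ hθ => ?_⟩
    set ℓ := Real.log (2 + N + Lknw + dknw + Fintype.card 𝕂) with hℓ
    have hN' : (1 : ℝ) ≤ N := by exact_mod_cast hN
    have hn' : (1 : ℝ) ≤ n := by exact_mod_cast hn1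
    have hd' : (1 : ℝ) ≤ dknw := by exact_mod_cast hd
    have hK0 : (0 : ℝ) ≤ Fintype.card 𝕂 := Nat.cast_nonneg _
    have hℓ1 : 1 ≤ ℓ := one_le_log (by linarith)
    obtain ⟨j, hj⟩ := exists_knowledgeCode hN knw hLk g hg (θ.1 : Measure (ParamBall dknw)) q φ ρ hθ
    have hmix := klDiv_uniformMixture_le
      (iidKernel (sentenceKernel knw syn sel enc henc) N θ) (fun k : Fin N => M (k + 1))
      ⟨n - 1, by omega⟩
    simp only [Nat.sub_add_cancel hn1, Fintype.card_fin] at hmix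
    have hcard : Real.log (Fintype.card ((Fin (n + 1) → Fin (N + 1)) ×
        (Fin n → Fin dknw → Fin m))) =
        (n + 1) * Real.log (N + 1) + n * (dknw * Real.log m) := by
      have hm0 : (m : ℝ) ≠ 0 := by positivity
      simp only [Fintype.card_prod, Fintype.card_pi, Fintype.card_fin, Finset.prod_const,
        Finset.card_univ]
      push_cast
      rw [Real.log_mul (by positivity) (by positivity), Real.log_pow, Real.log_pow, Real.log_pow]
      push_cast
      ring
    have hlogN : Real.log N ≤ ℓ := Real.log_le_log (by linarith) (by linarith)
    have hlogN1 : Real.log ((N : ℝ) + 1) ≤ ℓ := Real.log_le_log (by linarith) (by linarith)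
    have hlogm : Real.log m ≤ ℓ := Real.log_le_log (by exact_mod_cast hm1) (by linarith)
    have hlogK : Real.log (Fintype.card 𝕂) ≤ ℓ :=
      Real.log_le_log (by exact_mod_cast Fintype.card_pos) (by linarith)
    have hdℓ : 1 ≤ dknw * ℓ := by nlinarith
    have hℓd : ℓ ≤ dknw * ℓ := le_mul_of_one_le_left (by linarith) hd'
    have hdd : (dknw : ℝ) ≤ dknw * ℓ := le_mul_of_one_le_right (by linarith) hℓ1
    have hreal : ((n : ℝ) + 1) + dknw + ((n + 1) * Real.log (N + 1) + n * (dknw * Real.log m)) +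
        Real.log N ≤ 7 * (dknw * ℓ) * n := by
      have h1 : ((n : ℝ) + 1) * Real.log (N + 1) ≤ (2 * n) * (dknw * ℓ) := by
        have : Real.log ((N : ℝ) + 1) ≤ dknw * ℓ := hlogN1.trans hℓd
        have h0 : 0 ≤ Real.log ((N : ℝ) + 1) := Real.log_nonneg (by linarith)
        exact mul_le_mul (by linarith) this h0 (by positivity)
      have h2 : n * (dknw * Real.log m) ≤ n * (dknw * ℓ) := by gcongr
      have h3 : (n : ℝ) + 1 ≤ (2 * n) * (dknw * ℓ) := by
        calc (n : ℝ) + 1 ≤ (2 * n) * 1 := by linarith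
          _ ≤ _ := mul_le_mul_of_nonneg_left hdℓ (by positivity)
      have h4 : (dknw : ℝ) ≤ n * (dknw * ℓ) := hdd.trans (le_mul_of_one_le_left (by linarith) hn')
      have h5 : Real.log N ≤ n * (dknw * ℓ) :=
        (hlogN.trans hℓd).trans (le_mul_of_one_le_left (by linarith) hn')
      nlinarith
    have hlogs : 0 ≤ (n + 1) * Real.log (N + 1) + n * (dknw * Real.log m) := by
      have := Real.log_natCast_nonneg m
      have : 0 ≤ Real.log ((N : ℝ) + 1) := Real.log_nonneg (by linarith)
      positivity
    set σ := ENNReal.ofReal (2 * (ns * dsyn * Real.log (2 + N + Lsyn + dsyn))) with hσ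
    calc klDiv (iidKernel (sentenceKernel knw syn sel enc henc) N θ)
          (uniformMixture fun k : Fin N => M (k + 1))
        ≤ (((n + 1 : ℕ) + dknw + N * ρ Set.univ * ENNReal.ofReal (Real.log (Fintype.card 𝕂))) +
            ENNReal.ofReal ((n + 1) * Real.log (N + 1) + n * (dknw * Real.log m)) + σ) +
            ENNReal.ofReal (Real.log N) := by
          refine hmix.trans (add_le_add ((h n θ j).trans ?_) le_rfl)
          rw [hcard]
          gcongr
      _ = (ENNReal.ofReal ((n : ℝ) + 1) + ENNReal.ofReal dknw +
            ENNReal.ofReal ((n + 1) * Real.log (N + 1) + n * (dknw * Real.log m)) +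
            ENNReal.ofReal (Real.log N)) +
            ENNReal.ofReal (Real.log (Fintype.card 𝕂)) * (N * ρ Set.univ) + σ := by
          rw [ENNReal.ofReal_natCast, ← Nat.cast_succ, ENNReal.ofReal_natCast]
          ring
      _ = ENNReal.ofReal (((n : ℝ) + 1) + dknw +
            ((n + 1) * Real.log (N + 1) + n * (dknw * Real.log m)) + Real.log N) +
            ENNReal.ofReal (Real.log (Fintype.card 𝕂)) * (N * ρ Set.univ) + σ := by
          rw [ENNReal.ofReal_add (by positivity) (Real.log_natCast_nonneg _),
            ENNReal.ofReal_add (by positivity) hlogs, ENNReal.ofReal_add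
            (p := (n : ℝ) + 1) (by positivity) (Nat.cast_nonneg _)]
      _ ≤ ENNReal.ofReal (7 * (dknw * ℓ)) * n +
            ENNReal.ofReal (7 * (dknw * ℓ)) * (N * ρ Set.univ) + σ := by
          gcongr
          · rw [← ENNReal.ofReal_natCast n, ← ENNReal.ofReal_mul (by positivity)]
            exact ENNReal.ofReal_le_ofReal hreal
          · linarith
      _ = _ := by rw [mul_add]

end Universal

/-! ### Atoms of the Pitman-Yor process -/

section PitmanYorAtoms

variable {E : Type*} [MeasurableSpace E]

theorem measurable_tailWeight (m : ℕ) : Measurable (tailWeight m) := by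
  refine Measurable.tsum fun k => ?_
  refine Measurable.ite ?_ measurable_const (measurable_pyWeight k)
  exact (measurable_comp_history (n := m) (fun h => occupied h))
    (MeasurableSet.of_discrete (s := {A : Finset ℕ | k ∈ A}))

/-- The mixing distribution splits into one atom for each table that is occupied at time `m`, and a
remainder of mass at most `tailWeight m`. If the weights do not sum to one, then the mixing
distribution is a single atom and the statement holds as well, so that the almost sure convergence
of the table frequencies is not needed. -/
theorem exists_pyProb_eq_sum_add (m : ℕ) (x : (ℕ → ℕ) × (ℕ → E)) :
    ∃ (q : Fin (tables m x.1).card → ℝ≥0∞) (φ : Fin (tables m x.1).card → E) (ρ : Measure E),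
      ((pyProb x : ProbabilityMeasure E) : Measure E) = (∑ i, q i • Measure.dirac (φ i)) + ρ ∧
        ρ Set.univ ≤ tailWeight m x.1 := by
  classical
  by_cases h : ∑' k, pyWeight x.1 k = 1
  · set A := tables m x.1 with hA
    let e : Fin A.card ≃ A := A.equivFin.symm
    refine ⟨fun i => pyWeight x.1 (e i), fun i => x.2 (e i),
      Measure.sum fun k => (if k ∈ A then 0 else pyWeight x.1 k) • Measure.dirac (x.2 k), ?_, ?_⟩
    · rw [coe_pyProb_of_eq h, weightedAtoms]
      ext s hs
      rw [Measure.sum_apply _ hs, Measure.add_apply, Measure.sum_apply _ hs,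
        Measure.coe_finsetSum, Finset.sum_apply,
        e.sum_comp fun k : A => (pyWeight x.1 k • Measure.dirac (x.2 k)) s,
        Finset.sum_coe_sort A fun k => (pyWeight x.1 k • Measure.dirac (x.2 k)) s,
        sum_eq_tsum_indicator, ← ENNReal.tsum_add]
      refine tsum_congr fun k => ?_
      by_cases hk : k ∈ A <;> simp [hk]
    · rw [Measure.sum_apply _ MeasurableSet.univ, tailWeight]
      refine (tsum_congr fun k => ?_).le
      by_cases hk : k ∈ tables m x.1 <;> simp [hA, hk]
  · have hpos : 0 < (tables m x.1).card := Finset.card_pos.2 (occupied_nonempty _)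
    refine ⟨fun i => if i = ⟨0, hpos⟩ then 1 else 0, fun _ => x.2 0, 0, ?_, by simp⟩
    rw [coe_pyProb_of_ne h, add_zero, ← Finset.sum_smul]
    simp

end PitmanYorAtoms

/-! ### The bound on the mutual information -/

section Bound

variable {dknw dsyn ns : ℕ} {𝕂 : Type u} {Ξ : Type v} {S : Type w}
  [Fintype 𝕂] [MeasurableSpace 𝕂] [MeasurableSingletonClass 𝕂]
  [MeasurableSpace Ξ] [MeasurableSpace S]

/-- A function of the data parameter that is dominated, along `pyProb`, by a function of the seating
is dominated in the mean. -/
theorem lintegral_dataPrior_le (P : PYParam) (πknw : Measure (ParamBall dknw))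
    [IsProbabilityMeasure πknw] (πsyn : Measure (ParamBall dsyn)) [IsProbabilityMeasure πsyn]
    (f : DataParam dknw dsyn ns → ℝ≥0∞) {F : (ℕ → ℕ) → ℝ≥0∞} (hF : Measurable F)
    (h : ∀ x s, f (pyProb x, s) ≤ F x.1) :
    ∫⁻ θ, f θ ∂(dataPrior P πknw πsyn ns) ≤ ∫⁻ ω, F ω ∂(crp P) := by
  have hmap : dataPrior P πknw πsyn ns =
      (((crp P).prod (Measure.infinitePi fun _ : ℕ => πknw)).prod
        (Measure.pi fun _ : Fin ns => πsyn)).map (Prod.map pyProb id) := by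
    rw [dataPrior, pyp, ← Measure.map_prod_map _ _ measurable_pyProb measurable_id, Measure.map_id]
  have hfst : MeasurePreserving (fun z : ((ℕ → ℕ) × (ℕ → ParamBall dknw)) ×
      (Fin ns → ParamBall dsyn) => z.1.1)
      (((crp P).prod (Measure.infinitePi fun _ : ℕ => πknw)).prod
        (Measure.pi fun _ : Fin ns => πsyn)) (crp P) :=
    measurePreserving_fst.comp measurePreserving_fst
  rw [hmap]
  refine (lintegral_map_le _ _).trans ?_
  rw [← hfst.lintegral_comp hF]
  exact lintegral_mono fun z => h z.1 z.2

/-- The mutual information is at most the redundancy of the universal model, whose average over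
the prior is taken with the tables of the first `N` customers as listed clusters. -/
theorem mutualInfo_iidKernel_le [StandardBorelSpace S] (P : PYParam) {C : ℝ}
    (hC : ∀ m : ℕ,
      ∫⁻ ω, (((tables m ω).card : ℝ≥0∞) + ((m + 1 : ℕ) : ℝ≥0∞) * tailWeight m ω) ∂(crp P) ≤
      ENNReal.ofReal (C * (((m : ℝ) + 1) ^ P.α * (1 + Real.log ((m : ℝ) + 1)))))
    (N : ℕ) (hN : 1 ≤ N) (hns : 1 ≤ ns) [Nonempty 𝕂]
    (πknw : Measure (ParamBall dknw)) [IsProbabilityMeasure πknw]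
    (πsyn : Measure (ParamBall dsyn)) [IsProbabilityMeasure πsyn]
    (knw : Kernel (ParamBall dknw) 𝕂) [IsMarkovKernel knw]
    (syn : Kernel (ParamBall dsyn) Ξ) [IsMarkovKernel syn] (sel : 𝕂 → Fin ns)
    (enc : 𝕂 × Ξ → S) (henc : Measurable enc) {Lknw Lsyn : ℝ} (hLk0 : 0 < Lknw)
    (hLs0 : 0 < Lsyn) (hLk : LipschitzKL knw Lknw) (hLs : LipschitzKL syn Lsyn) :
    mutualInfo (dataPrior P πknw πsyn ns)
        (iidKernel (sentenceKernel knw syn sel enc henc) N) ≤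
      ENNReal.ofReal (7 * (dknw * Real.log (2 + N + Lknw + dknw + Fintype.card 𝕂))) *
          ENNReal.ofReal (C * ((N : ℝ) ^ P.α * (1 + Real.log N))) +
        ENNReal.ofReal (2 * (ns * dsyn * Real.log (2 + N + Lsyn + dsyn))) := by
  obtain ⟨m, rfl⟩ : ∃ m, N = m + 1 := ⟨N - 1, by omega⟩
  obtain ⟨M, hM, h⟩ := exists_model (m + 1) hN hns knw syn sel enc henc hLk0 hLs0 hLk hLs
  set a := ENNReal.ofReal
    (7 * (dknw * Real.log (2 + (m + 1 : ℕ) + Lknw + dknw + Fintype.card 𝕂))) with ha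
  set σ := ENNReal.ofReal (2 * (ns * dsyn * Real.log (2 + (m + 1 : ℕ) + Lsyn + dsyn))) with hσ
  have hmeas : Measurable fun ω : ℕ → ℕ =>
      ((tables m ω).card : ℝ≥0∞) + ((m + 1 : ℕ) : ℝ≥0∞) * tailWeight m ω :=
    (measurable_comp_history fun h => ((occupied h).card : ℝ≥0∞)).add
      ((measurable_tailWeight m).const_mul _)
  calc mutualInfo (dataPrior P πknw πsyn ns)
        (iidKernel (sentenceKernel knw syn sel enc henc) (m + 1))
      ≤ ∫⁻ θ, klDiv (iidKernel (sentenceKernel knw syn sel enc henc) (m + 1) θ) M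
          ∂(dataPrior P πknw πsyn ns) := mutualInfo_le_lintegral_klDiv _ _ _
    _ ≤ ∫⁻ ω, (a * (((tables m ω).card : ℝ≥0∞) + ((m + 1 : ℕ) : ℝ≥0∞) * tailWeight m ω) + σ)
          ∂(crp P) := by
        refine lintegral_dataPrior_le P πknw πsyn _ ((hmeas.const_mul a).add_const σ) fun x s => ?_
        obtain ⟨q, φ, ρ, hx, hρ⟩ := exists_pyProb_eq_sum_add m x
        have hcard : (tables m x.1).card ≤ m + 1 := by
          rw [tables, occupied_history]
          exact Finset.card_image_le.trans (by simp)
        refine (h (pyProb x, s) _ (Finset.card_pos.2 (occupied_nonempty _)) hcard q φ ρ hx).trans ?_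
        gcongr
    _ = a * ∫⁻ ω, (((tables m ω).card : ℝ≥0∞) + ((m + 1 : ℕ) : ℝ≥0∞) * tailWeight m ω) ∂(crp P) +
          σ := by
        rw [lintegral_add_right _ measurable_const, lintegral_const_mul _ hmeas]
        simp
    _ ≤ _ := by
        gcongr
        simpa using hC m

end Bound

end SyntaxKnowledge

theorem mainTheorem1 (P : PYParam) :
    ∃ C : ℝ, 0 < C ∧ ∃ r : ℕ,
      ∀ (dknw dsyn ns : ℕ)
        (𝕂 : Type u) [Fintype 𝕂] [MeasurableSpace 𝕂] [MeasurableSingletonClass 𝕂]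
        (Ξ : Type v) [MeasurableSpace Ξ] [StandardBorelSpace Ξ]
        (S : Type w) [MeasurableSpace S] [StandardBorelSpace S]
        (πknw : Measure (ParamBall dknw)) [IsProbabilityMeasure πknw]
        (πsyn : Measure (ParamBall dsyn)) [IsProbabilityMeasure πsyn]
        (knw : Kernel (ParamBall dknw) 𝕂) [IsMarkovKernel knw]
        (syn : Kernel (ParamBall dsyn) Ξ) [IsMarkovKernel syn]
        (sel : 𝕂 → Fin ns) (enc : 𝕂 × Ξ → S) (henc : Measurable enc)
        (_ : Function.Injective enc)
        (Lknw Lsyn : ℝ) (_ : 0 < Lknw) (_ : 0 < Lsyn)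
        (_ : LipschitzKL knw Lknw) (_ : LipschitzKL syn Lsyn)
        (N : ℕ) (_ : 1 ≤ N),
        (⨅ M : ProbabilityMeasure (Fin N → S),
            bayesRedundancy (dataPrior P πknw πsyn ns) (sentenceKernel knw syn sel enc henc) N M
              / (N : ℝ≥0∞)) =
          mutualInfo (dataPrior P πknw πsyn ns)
            (iidKernel (sentenceKernel knw syn sel enc henc) N) / (N : ℝ≥0∞) ∧
        mutualInfo (dataPrior P πknw πsyn ns)
            (iidKernel (sentenceKernel knw syn sel enc henc) N) / (N : ℝ≥0∞) ≤
          ENNReal.ofReal (C *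
            ((dknw : ℝ) / (N : ℝ) ^ (1 - P.α) *
                Real.log (2 + N + Lknw + dknw + Fintype.card 𝕂) ^ r +
              (ns : ℝ) * (dsyn : ℝ) / (N : ℝ) *
                Real.log (2 + N + Lsyn + dsyn) ^ r)) := by
  obtain ⟨C₀, hC₀, hcrp⟩ := exists_lintegral_card_add_tailWeight_le P
  refine ⟨14 * C₀ + 2, by positivity, 2, ?_⟩
  intro dknw dsyn ns 𝕂 _ _ _ Ξ _ _ S _ _ πknw _ πsyn _ knw _ syn _ sel enc henc _ Lknw Lsyn
    hLk0 hLs0 hLk hLs N hN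
  refine ⟨iInf_bayesRedundancy_div _ _ N, ?_⟩
  -- a Markov kernel into `𝕂` forces `𝕂`, and with it the set of syntax clusters, to be nonempty
  have h𝕂 : Nonempty 𝕂 := by
    by_contra hempty
    rw [not_nonempty_iff] at hempty
    have h1 : knw ⟨0, by simp⟩ Set.univ = 1 := measure_univ
    rw [Set.univ_eq_empty_iff.2 hempty, measure_empty] at h1
    exact zero_ne_one h1
  have hns : 1 ≤ ns := (sel h𝕂.some).pos
  have hN' : (1 : ℝ) ≤ N := by exact_mod_cast hN
  have hN0 : (0 : ℝ) < N := by linarith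
  have hd0 : (0 : ℝ) ≤ dknw := Nat.cast_nonneg _
  have hds0 : (0 : ℝ) ≤ dsyn := Nat.cast_nonneg _
  have hK0 : (0 : ℝ) ≤ Fintype.card 𝕂 := Nat.cast_nonneg _
  set ℓ := Real.log (2 + N + Lknw + dknw + Fintype.card 𝕂) with hℓ
  set ℓs := Real.log (2 + N + Lsyn + dsyn) with hℓs
  have hℓ1 : 1 ≤ ℓ := one_le_log (by linarith)
  have hℓs1 : 1 ≤ ℓs := one_le_log (by linarith)
  have hlogN : Real.log N ≤ ℓ := Real.log_le_log hN0 (by linarith)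
  have hlogN0 : 0 ≤ Real.log N := Real.log_nonneg hN'
  have hmi := mutualInfo_iidKernel_le P hcrp N hN hns πknw πsyn knw syn sel enc henc hLk0 hLs0
    hLk hLs
  rw [← hℓ, ← hℓs, ← ENNReal.ofReal_mul (by positivity), ← ENNReal.ofReal_add (by positivity)
    (by positivity)] at hmi
  calc mutualInfo (dataPrior P πknw πsyn ns)
        (iidKernel (sentenceKernel knw syn sel enc henc) N) / (N : ℝ≥0∞)
      ≤ ENNReal.ofReal (7 * (dknw * ℓ) * (C₀ * ((N : ℝ) ^ P.α * (1 + Real.log N))) +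
          2 * (ns * dsyn * ℓs)) / (N : ℝ≥0∞) := by gcongr
    _ = ENNReal.ofReal ((7 * (dknw * ℓ) * (C₀ * ((N : ℝ) ^ P.α * (1 + Real.log N))) +
          2 * (ns * dsyn * ℓs)) / N) := by
        rw [ENNReal.ofReal_div_of_pos hN0, ENNReal.ofReal_natCast]
    _ ≤ _ := by
        refine ENNReal.ofReal_le_ofReal ?_
        have hpow : (dknw : ℝ) / (N : ℝ) ^ (1 - P.α) = dknw * (N : ℝ) ^ P.α / N := by
          rw [Real.rpow_sub hN0, Real.rpow_one, div_div_eq_mul_div]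
        have h1 : 7 * (dknw * ℓ) * (C₀ * ((N : ℝ) ^ P.α * (1 + Real.log N))) ≤
            (14 * C₀ + 2) * (dknw * (N : ℝ) ^ P.α * ℓ ^ 2) := by
          calc 7 * (dknw * ℓ) * (C₀ * ((N : ℝ) ^ P.α * (1 + Real.log N)))
              ≤ 7 * (dknw * ℓ) * (C₀ * ((N : ℝ) ^ P.α * (ℓ + ℓ))) := by gcongr
            _ = 14 * C₀ * (dknw * (N : ℝ) ^ P.α * ℓ ^ 2) := by ring
            _ ≤ _ := by gcongr; linarith
        have h2 : 2 * (ns * dsyn * ℓs) ≤ (14 * C₀ + 2) * (ns * dsyn * ℓs ^ 2) := by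
          have : ℓs ≤ ℓs ^ 2 := le_self_pow₀ hℓs1 two_ne_zero
          gcongr
          linarith
        rw [hpow, div_le_iff₀ hN0]
        calc _ ≤ (14 * C₀ + 2) * (dknw * (N : ℝ) ^ P.α * ℓ ^ 2) +
              (14 * C₀ + 2) * (ns * dsyn * ℓs ^ 2) := add_le_add h1 h2
          _ = _ := by field_simp
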